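/- Let $M$ be a topological space with base point $x$. For $\alpha\in\pi_p(M,x)$, $\beta\in\pi_q(M,x)$ with $p,q\ge 1$, represented by maps $f\colon (D^p,\partial D^p)\to (M,x)$ and $g\colon (D^q,\partial D^q)\to (M,x)$, the Whitehead product $[\alpha,\beta]\in\pi_{p+q-1}(M,x)$ is the class of the map $$\partial(D^p\times D^q)=(\partial D^p\times D^q)\cup(D^p\times\partial D^q)\to M$$ given by $(a,b)\mapsto g(b)$ on $\partial D^p\times D^q$ and $(a,b)\mapsto f(a)$ on $D^p\times\partial D^q$, where the sphere $\partial (D^p\times D^q)$ is oriented as the boundary of $D^p\times D^q$ (with the product orientation) by the outward-normal-first convention. Then for all $p,q,r\ge 2$ and all $\alpha\in\pi_p(M,x)$, $\beta\in\pi_q(M,x)$, $\gamma\in\pi_r(M,x)$, the following identity holds in $\pi_{p+q+r-2}(M,x)$: $$[[\alpha,\beta],\gamma]+(-1)^{pq+pr}[[\beta,\gamma],\alpha]+(-1)^{pr+qr}[[\gamma,\alpha],\beta]=0 .$$ -/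

import Mathlib

open scoped unitInterval Topology Topology.Homotopy

noncomputable section

namespace Whitehead

variable {M : Type*} [TopologicalSpace M] {x : M} {p q n : ℕ}

/-- The boundary sphere `∂(I^p × I^q) = (∂I^p × I^q) ∪ (I^p × ∂I^q)` of a product of two cubes. -/
def sphere (p q : ℕ) : Set ((I^(Fin p)) × (I^(Fin q))) :=
  {z | z.1 ∈ Cube.boundary (Fin p) ∨ z.2 ∈ Cube.boundary (Fin q)}

theorem isClosed_boundary (k : ℕ) : IsClosed (Cube.boundary (Fin k)) := by
  have h : Cube.boundary (Fin k) = ⋃ i : Fin k, {y | y i = 0} ∪ {y | y i = 1} := by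
    ext y; simp [Cube.boundary]
  rw [h]
  exact isClosed_iUnion_of_finite fun i =>
    (isClosed_eq (continuous_apply i) continuous_const).union
      (isClosed_eq (continuous_apply i) continuous_const)

open Classical in
theorem continuous_glue {T : Type*} [TopologicalSpace T] {F : T × (I^(Fin p)) → M}
    {G : T × (I^(Fin q)) → M} (hF : Continuous F) (hG : Continuous G)
    (hFx : ∀ t, ∀ a ∈ Cube.boundary (Fin p), F (t, a) = x)
    (hGx : ∀ t, ∀ b ∈ Cube.boundary (Fin q), G (t, b) = x) :
    Continuous fun z : T × sphere p q =>
      if z.2.1.1 ∈ Cube.boundary (Fin p) then G (z.1, z.2.1.2) else F (z.1, z.2.1.1) := by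
  let A : Set (T × sphere p q) := {z | z.2.1.1 ∈ Cube.boundary (Fin p)}
  let B : Set (T × sphere p q) := {z | z.2.1.2 ∈ Cube.boundary (Fin q)}
  have hA : IsClosed A := (isClosed_boundary p).preimage (by fun_prop)
  have hB : IsClosed B := (isClosed_boundary q).preimage (by fun_prop)
  have hAB : Aᶜ ⊆ B := fun z hz => z.2.2.resolve_left hz
  refine Continuous.if (fun z hz => ?_) (by fun_prop) (by fun_prop)
  have h1 : z ∈ A := hA.frontier_subset hz
  have h2 : z ∈ B := by
    rw [frontier_eq_closure_inter_closure] at hz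
    exact closure_minimal hAB hB hz.2
  rw [hGx _ _ h2, hFx _ _ h1]

open Classical in
/-- The map `∂(I^p × I^q) → I^p/∂I^p ∨ I^q/∂I^q → M` given by `f` and `g`: the attaching map of the
top cell of the product of two spheres, followed by `f ∨ g`. It is `(a, b) ↦ g b` on
`∂I^p × I^q` and `(a, b) ↦ f a` on `I^p × ∂I^q`; both are the base point on `∂I^p × ∂I^q`. -/
def attach (f : Ω^ (Fin p) M x) (g : Ω^ (Fin q) M x) : C(sphere p q, M) where
  toFun z := if z.1.1 ∈ Cube.boundary (Fin p) then g z.1.2 else f z.1.1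
  continuous_toFun :=
    (continuous_glue (T := Unit) (F := fun z => f z.2) (G := fun z => g z.2)
      (f.1.continuous.comp continuous_snd) (g.1.continuous.comp continuous_snd)
      (fun _ => f.2) (fun _ => g.2)).comp (by fun_prop : Continuous fun z => ((), z))

/-- The sup-distance of a point of the cube `I^n` from the centre of the cube. -/
def radius (z : I^(Fin n)) : ℝ := dist (fun i => (z i : ℝ)) (fun _ => 1 / 2)

/-- The retraction of `ℝ` onto `I`. -/
abbrev clamp (t : ℝ) : I := Set.projIcc 0 1 zero_le_one t

/-- The standard map of degree one from `I^n / ∂I^n` to the boundary of `I^(n+1)`. On the inner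
cube `[1/3, 2/3]^n` it is the affine identification `z ↦ (1, 3z - 1)` with the face `{1} × I^n`,
and no other point is mapped to the interior of this face; the shell `1/6 ≤ radius ≤ 1/3` goes to
the side faces `I × ∂I^n`, and the shell `1/3 ≤ radius ≤ 1/2` to the face `{0} × I^n`, so that
`∂I^n` goes to the vertex `(0, …, 0)`. As the outward normal of `{1} × I^n` is the first coordinate
vector, the degree is `+1` for the boundary orientation with the outward normal first. -/
def collapseFun (z : I^(Fin n)) : I^(Fin (n + 1)) :=
  Fin.cons (clamp (2 - 6 * radius z)) fun i => clamp (3 - 6 * radius z) * clamp (3 * z i - 1)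

theorem continuous_radius : Continuous (radius (n := n)) := by
  unfold radius; fun_prop

theorem continuous_collapseFun : Continuous (collapseFun (n := n)) := by
  have h := continuous_radius (n := n)
  refine continuous_pi fun i => ?_
  refine Fin.cases ?_ (fun j => ?_) i
  · simp only [collapseFun, Fin.cons_zero]
    exact continuous_projIcc.comp (by fun_prop)
  · simp only [collapseFun, Fin.cons_succ]
    exact (continuous_projIcc.comp (by fun_prop)).mul (continuous_projIcc.comp (by fun_prop))

theorem collapseFun_mem (z : I^(Fin n)) : collapseFun z ∈ Cube.boundary (Fin (n + 1)) := by
  rcases le_or_gt (radius z) (1 / 6) with h | h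
  · exact ⟨0, Or.inr (Set.projIcc_of_right_le zero_le_one (by linarith))⟩
  rcases le_or_gt (1 / 3) (radius z) with h' | h'
  · exact ⟨0, Or.inl (Set.projIcc_of_le_left zero_le_one (by linarith))⟩
  have : ∃ i, 1 / 6 < dist (z i : ℝ) (1 / 2) := by
    by_contra! hc
    exact absurd ((dist_pi_le_iff (by norm_num)).2 hc) (not_le.2 h)
  obtain ⟨i, hi⟩ := this
  have hs : clamp (3 - 6 * radius z) = 1 := Set.projIcc_of_right_le zero_le_one (by linarith)
  refine ⟨i.succ, ?_⟩
  simp only [collapseFun, Fin.cons_succ, hs, one_mul]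
  rw [Real.dist_eq, lt_abs] at hi
  rcases hi with hi | hi
  · exact Or.inr (Set.projIcc_of_right_le zero_le_one (by linarith))
  · exact Or.inl (Set.projIcc_of_le_left zero_le_one (by linarith))

theorem collapseFun_of_mem {z : I^(Fin n)} (hz : z ∈ Cube.boundary (Fin n)) (i : Fin (n + 1)) :
    collapseFun z i = 0 := by
  have h : 1 / 2 ≤ radius z := by
    obtain ⟨j, hj⟩ := hz
    refine le_trans ?_ (dist_le_pi_dist _ _ j)
    rcases hj with hj | hj <;> simp [hj, Real.dist_eq] <;> norm_num
  refine Fin.cases ?_ (fun j => ?_) i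
  · exact Set.projIcc_of_le_left zero_le_one (by linarith)
  · have hs : clamp (3 - 6 * radius z) = 0 := Set.projIcc_of_le_left zero_le_one (by linarith)
    simp only [collapseFun, Fin.cons_succ, hs, zero_mul]

/-- The same map, with `I^(n+1)` written as `I^p × I^q`: the first `p` and the last `q`
coordinates. -/
def collapse (h : n + 1 = p + q) : C(I^(Fin n), sphere p q) where
  toFun z :=
    ⟨(fun i => collapseFun z (Fin.cast h.symm (Fin.castAdd q i)),
      fun j => collapseFun z (Fin.cast h.symm (Fin.natAdd p j))), by
      obtain ⟨k, hk⟩ := collapseFun_mem z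
      obtain ⟨k, rfl⟩ : ∃ k', k = Fin.cast h.symm k' := ⟨Fin.cast h k, by simp⟩
      induction k using Fin.addCases with
      | left i => exact Or.inl ⟨i, hk⟩
      | right j => exact Or.inr ⟨j, hk⟩⟩
  continuous_toFun := by
    have hc := continuous_collapseFun (n := n)
    fun_prop

theorem collapse_fst_mem (hp : 1 ≤ p) (h : n + 1 = p + q) {z : I^(Fin n)}
    (hz : z ∈ Cube.boundary (Fin n)) : (collapse h z).1.1 ∈ Cube.boundary (Fin p) :=
  ⟨⟨0, hp⟩, Or.inl (collapseFun_of_mem hz (Fin.cast h.symm (Fin.castAdd q ⟨0, hp⟩)))⟩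

theorem collapse_snd_mem (hq : 1 ≤ q) (h : n + 1 = p + q) {z : I^(Fin n)}
    (hz : z ∈ Cube.boundary (Fin n)) : (collapse h z).1.2 ∈ Cube.boundary (Fin q) :=
  ⟨⟨0, hq⟩, Or.inl (collapseFun_of_mem hz (Fin.cast h.symm (Fin.natAdd p ⟨0, hq⟩)))⟩

/-- The representative `I^n → ∂(I^p × I^q) → M`, `n = p + q - 1`, of the Whitehead product of
`f` and `g`. -/
def loop (hp : 1 ≤ p) (hq : 1 ≤ q) (h : n + 1 = p + q) (f : Ω^ (Fin p) M x)
    (g : Ω^ (Fin q) M x) : Ω^ (Fin n) M x :=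
  ⟨(attach f g).comp (collapse h), fun z hz => by
    have h1 := collapse_fst_mem hp h hz
    have h2 := collapse_snd_mem hq h hz
    simp only [attach, ContinuousMap.comp_apply, ContinuousMap.coe_mk, if_pos h1]
    exact g.2 _ h2⟩

open Classical in
theorem loop_homotopic (hp : 1 ≤ p) (hq : 1 ≤ q) (h : n + 1 = p + q)
    {f f' : Ω^ (Fin p) M x} {g g' : Ω^ (Fin q) M x} (hf : GenLoop.Homotopic f f')
    (hg : GenLoop.Homotopic g g') :
    GenLoop.Homotopic (loop hp hq h f g) (loop hp hq h f' g') := by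
  obtain ⟨F⟩ := hf
  obtain ⟨G⟩ := hg
  have hF : ∀ t, ∀ a ∈ Cube.boundary (Fin p), F (t, a) = x := fun t a ha =>
    (F.eq_fst t ha).trans (f.2 a ha)
  have hG : ∀ t, ∀ b ∈ Cube.boundary (Fin q), G (t, b) = x := fun t b hb =>
    (G.eq_fst t hb).trans (g.2 b hb)
  have hc := continuous_glue F.continuous G.continuous hF hG
  refine ⟨⟨⟨⟨_, hc.comp (continuous_fst.prodMk
    ((collapse h).continuous.comp continuous_snd))⟩, fun z => ?_, fun z => ?_⟩, fun t z hz => ?_⟩⟩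
  · simp [loop, attach]
  · simp [loop, attach]
  · have h1 := collapse_fst_mem hp h hz
    have h2 := collapse_snd_mem hq h hz
    simp [loop, attach, h1, hG _ _ h2, GenLoop.boundary g _ h2]

end Whitehead

/-- The Whitehead product `[α, β] ∈ π_n(M)`, `n = p + q - 1`, of `α ∈ π_p(M)` and `β ∈ π_q(M)`. -/
def whitehead {M : Type*} [TopologicalSpace M] {x : M} {p q n : ℕ} (hp : 1 ≤ p) (hq : 1 ≤ q)
    (h : n + 1 = p + q) (α : π_ p M x) (β : π_ q M x) : π_ n M x :=
  Quotient.map₂ (Whitehead.loop hp hq h)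
    (fun _ _ hf _ _ hg => Whitehead.loop_homotopic hp hq h hf hg) α β

end

open scoped unitInterval Topology Topology.Homotopy

noncomputable section

/-! ### Loops of maps on a torus -/

namespace Whitehead

variable {M : Type*} [TopologicalSpace M] {x : M} {K K' N : Type*}

/-! The homotopy groups of `M` embed in a nonabelian group where Whitehead products become
commutators, and the Jacobi identity becomes the Hall–Witt identity. The group is Fox's torus
homotopy group `TorusGroup x K`, the fundamental group of the space of maps to `M` from the torus
with directions `K`. Singling out one coordinate of a generalized loop as loop parameter gives
`toTorus`, a homomorphism that is injective for finite `K` (`toTorusHom_injective`).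

Each of `α`, `β`, `γ` has a loop coordinate and a block of remaining coordinates. Pulled back to the
torus on the union of the three blocks, they give elements `X`, `Y`, `Z`. The loop coordinates of
two factors span a square, and running around its boundary turns the Whitehead product of `α` and
`β` into `⁅Y, X⁆` up to sign (`toTorus_loop`, `toTorus_whitehead`).

Elements represented by loops that equal `x` on the faces of a common direction commute
(`Vanishes.commute`), so the conjugations in the Hall–Witt identity drop out
(`hallWitt_of_commute`). This needs every block to be nonempty, that is, degrees at least 2.

Permuting coordinates raises a class to the sign of the permutation (`permAct_eq_zpow_sign`). The
signs come from moving loop coordinates to the front and from rotating the three blocks;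
`jacobi_signs` compares them with those of the theorem. -/

/-- Two points of the cube are congruent if they agree after gluing opposite faces. -/
def Cong (z z' : K → I) : Prop :=
  ∀ i, z i = z' i ∨ ((z i = 0 ∨ z i = 1) ∧ (z' i = 0 ∨ z' i = 1))

theorem Cong.comp {z z' : K' → I} (h : Cong z z') (φ : K → K') :
    Cong (fun k => z (φ k)) fun k => z' (φ k) := fun i => h (φ i)

theorem Cong.mem_boundary {z z' : K → I} (h : Cong z z') (hz : z ∈ Cube.boundary K) :
    z' ∈ Cube.boundary K := by
  obtain ⟨i, hi⟩ := hz
  rcases h i with h | h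
  · exact ⟨i, h ▸ hi⟩
  · exact ⟨i, h.2⟩

theorem Cong.symm {z z' : K → I} (h : Cong z z') : Cong z' z := fun i =>
  (h i).imp Eq.symm And.symm

theorem Cong.eq_or_mem {z z' : K → I} (h : Cong z z') : z = z' ∨ z ∈ Cube.boundary K := by
  by_cases hz : z = z'
  · exact Or.inl hz
  · obtain ⟨i, hi⟩ := Function.ne_iff.1 hz
    exact Or.inr ⟨i, ((h i).resolve_left hi).1⟩

theorem GenLoop.apply_eq_of_cong (f : Ω^ K M x) {z z' : K → I} (h : Cong z z') : f z = f z' := by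
  rcases h.eq_or_mem with h' | h'
  · rw [h']
  · exact (f.2 z h').trans (f.2 z' (h.mem_boundary h')).symm

/-- Maps on the cube `I^K` that are compatible with gluing opposite faces, and that take the
value `x` on the faces with a direction in `S`. -/
def PerMap (x : M) (S : Set K) : Set C(K → I, M) :=
  {f | (∀ z z', Cong z z' → f z = f z') ∧ ∀ z, ∀ i ∈ S, (z i = 0 ∨ z i = 1) → f z = x}

/-- The constant map. -/
def PerMap.const (x : M) (S : Set K) : PerMap x S :=
  ⟨ContinuousMap.const _ x, fun _ _ _ => rfl, fun _ _ _ _ => rfl⟩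

/-- Loops of maps based at the constant map. -/
abbrev PerLoop (x : M) (S : Set K) := Path (PerMap.const x S) (PerMap.const x S)

/-- A loop of maps, from a continuous function of all variables. -/
def PerLoop.mk {S : Set K} (w : I × (K → I) → M) (hw : Continuous w) (h0 : ∀ z, w (0, z) = x)
    (h1 : ∀ z, w (1, z) = x) (hc : ∀ t z z', Cong z z' → w (t, z) = w (t, z'))
    (hS : ∀ t z, ∀ i ∈ S, (z i = 0 ∨ z i = 1) → w (t, z) = x) : PerLoop x S where
  toFun t := ⟨ContinuousMap.curry ⟨w, hw⟩ t, fun z z' h => hc t z z' h, fun z i hi h => hS t z i hi h⟩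
  continuous_toFun := by fun_prop
  source' := Subtype.ext (ContinuousMap.ext h0)
  target' := Subtype.ext (ContinuousMap.ext h1)

theorem PerLoop.continuous_uncurry {S : Set K} (γ : PerLoop x S) :
    Continuous fun y : I × (K → I) => (γ y.1).1 y.2 := by
  have : Continuous fun y : I × (K → I) => (γ y.1).1 := by fun_prop
  exact this.eval continuous_snd

theorem PerLoop.homotopic_of {S : Set K} {γ γ' : PerLoop x S} (H : I × I × (K → I) → M)
    (hH : Continuous H) (h0 : ∀ t z, H (0, t, z) = (γ t).1 z) (h1 : ∀ t z, H (1, t, z) = (γ' t).1 z)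
    (hl : ∀ u z, H (u, 0, z) = x) (hr : ∀ u z, H (u, 1, z) = x)
    (hc : ∀ u t z z', Cong z z' → H (u, t, z) = H (u, t, z'))
    (hS : ∀ u t z, ∀ i ∈ S, (z i = 0 ∨ z i = 1) → H (u, t, z) = x) : γ.Homotopic γ' := by
  have hH' : Continuous fun y : (I × I) × (K → I) => H (y.1.1, y.1.2, y.2) := by fun_prop
  refine ⟨⟨⟨⟨fun y => ⟨ContinuousMap.curry ⟨_, hH'⟩ y, fun z z' h => hc y.1 y.2 z z' h,
    fun z i hi h => hS y.1 y.2 z i hi h⟩, by fun_prop⟩, fun t => Subtype.ext (ContinuousMap.ext (h0 t)),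
    fun t => Subtype.ext (ContinuousMap.ext (h1 t))⟩, ?_⟩⟩
  rintro u t (rfl | ht)
  · exact (Subtype.ext (ContinuousMap.ext (hl u))).trans γ.source.symm
  · rw [Set.mem_singleton_iff.1 ht]
    exact (Subtype.ext (ContinuousMap.ext (hr u))).trans γ.target.symm

theorem PerLoop.exists_of_homotopic {S : Set K} {γ γ' : PerLoop x S} (h : γ.Homotopic γ') :
    ∃ H : I × I × (K → I) → M, Continuous H ∧ (∀ t z, H (0, t, z) = (γ t).1 z) ∧
      (∀ t z, H (1, t, z) = (γ' t).1 z) ∧ (∀ u z, H (u, 0, z) = x) ∧ (∀ u z, H (u, 1, z) = x) ∧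
      (∀ u t z z', Cong z z' → H (u, t, z) = H (u, t, z')) ∧
      ∀ u t z, ∀ i ∈ S, (z i = 0 ∨ z i = 1) → H (u, t, z) = x := by
  obtain ⟨F⟩ := h
  refine ⟨fun y => (F (y.1, y.2.1)).1 y.2.2, ?_, ?_, ?_, ?_, ?_, ?_, ?_⟩
  · have : Continuous fun y : I × I × (K → I) => (F (y.1, y.2.1)).1 := by fun_prop
    exact this.eval (by fun_prop)
  · intro t z; simp
  · intro t z; simp
  · intro u z; simp only [F.source]; rfl
  · intro u z; simp only [F.target]; rfl
  · intro u t z z' h; exact (F (u, t)).2.1 z z' h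
  · intro u t z i hi h; exact (F (u, t)).2.2 z i hi h

/-- The group of homotopy classes of loops of maps on the torus. -/
abbrev TorusGroup (x : M) (K : Type*) := FundamentalGroup (PerMap x (∅ : Set K)) (PerMap.const x ∅)

/-- The class of a loop. -/
def cls (γ : PerLoop x (∅ : Set K)) : TorusGroup x K :=
  FundamentalGroup.fromPath (Path.Homotopic.Quotient.mk γ)

theorem cls_eq_iff {γ γ' : PerLoop x (∅ : Set K)} : cls γ = cls γ' ↔ γ.Homotopic γ' :=
  Path.Homotopic.Quotient.eq

/-- The product reverses concatenation, which is why brackets below appear as `⁅Y, X⁆` rather than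
`⁅X, Y⁆`. -/
theorem cls_trans (γ γ' : PerLoop x (∅ : Set K)) : cls (γ.trans γ') = cls γ' * cls γ := rfl

theorem cls_symm (γ : PerLoop x (∅ : Set K)) : cls γ.symm = (cls γ)⁻¹ := rfl

/-- Precomposition with the map of cubes induced by a map of index types. -/
def PerMap.push (φ : K → K') : C(PerMap x (∅ : Set K), PerMap x (∅ : Set K')) where
  toFun f := ⟨f.1.comp ⟨fun z k => z (φ k), by fun_prop⟩, fun _ _ h => f.2.1 _ _ (h.comp φ), by simp⟩
  continuous_toFun := by fun_prop

/-- The homomorphism of torus groups induced by a map of index types. -/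
def pushHom (x : M) (φ : K → K') : TorusGroup x K →* TorusGroup x K' :=
  FundamentalGroup.map (PerMap.push φ) (PerMap.const x ∅)

/-- Precomposition of a loop with the map of cubes induced by a map of index types. -/
def PerLoop.push (φ : K → K') (γ : PerLoop x (∅ : Set K)) : PerLoop x (∅ : Set K') :=
  γ.map (PerMap.push φ).continuous

theorem PerLoop.push_apply (φ : K → K') (γ : PerLoop x (∅ : Set K)) (t : I) (z : K' → I) :
    (PerLoop.push φ γ t).1 z = (γ t).1 fun k => z (φ k) := rfl

theorem pushHom_cls (φ : K → K') (γ : PerLoop x (∅ : Set K)) :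
    pushHom x φ (cls γ) = cls (PerLoop.push φ γ) := rfl

theorem pushHom_pushHom {K'' : Type*} (φ : K → K') (ψ : K' → K'') (g : TorusGroup x K) :
    pushHom x ψ (pushHom x φ g) = pushHom x (ψ ∘ φ) g := by
  induction g using Path.Homotopic.Quotient.ind
  rfl

/-! ### Generalized loops as loops of maps -/

/-- The point of the cube `I^N` with coordinate `t` in the direction `e.symm none`. -/
def ins (e : N ≃ Option K) (t : I) (z : K → I) : N → I := fun m => (e m).elim t z

theorem continuous_ins (e : N ≃ Option K) : Continuous fun y : I × (K → I) => ins e y.1 y.2 := by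
  refine continuous_pi fun m => ?_
  unfold ins
  rcases e m with _ | k
  · exact continuous_fst
  · exact (continuous_apply k).comp continuous_snd

theorem ins_mem_of_left (e : N ≃ Option K) {t : I} (z : K → I) (ht : t = 0 ∨ t = 1) :
    ins e t z ∈ Cube.boundary N := ⟨e.symm none, by simpa [ins] using ht⟩

theorem ins_mem_of_right (e : N ≃ Option K) (t : I) {z : K → I} (hz : z ∈ Cube.boundary K) :
    ins e t z ∈ Cube.boundary N := by
  obtain ⟨k, hk⟩ := hz
  exact ⟨e.symm (some k), by simpa [ins] using hk⟩

theorem Cong.ins {z z' : K → I} (h : Cong z z') (e : N ≃ Option K) (t : I) :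
    Cong (ins e t z) (ins e t z') := by
  intro m
  unfold Whitehead.ins
  rcases e m with _ | k
  · exact Or.inl rfl
  · exact h k

/-- A generalized loop as a loop of maps. -/
def toPerLoop (S : Set K) (e : N ≃ Option K) (f : Ω^ N M x) : PerLoop x S :=
  PerLoop.mk (fun y => f (ins e y.1 y.2)) (f.1.continuous.comp (continuous_ins e))
    (fun z => f.2 _ (ins_mem_of_left e z (Or.inl rfl)))
    (fun z => f.2 _ (ins_mem_of_left e z (Or.inr rfl)))
    (fun t _ _ h => GenLoop.apply_eq_of_cong f (h.ins e t))
    (fun t _ i _ hi => f.2 _ (ins_mem_of_right e t ⟨i, hi⟩))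

theorem toPerLoop_apply (S : Set K) (e : N ≃ Option K) (f : Ω^ N M x) (t : I) (z : K → I) :
    (toPerLoop S e f t).1 z = f (ins e t z) := rfl

theorem toPerLoop_homotopic (S : Set K) (e : N ≃ Option K) {f g : Ω^ N M x}
    (h : GenLoop.Homotopic f g) : (toPerLoop S e f).Homotopic (toPerLoop S e g) := by
  obtain ⟨F⟩ := h
  have hb : ∀ u, ∀ y ∈ Cube.boundary N, F (u, y) = x := fun u y hy =>
    (F.eq_fst u hy).trans (f.2 y hy)
  refine PerLoop.homotopic_of (fun y => F (y.1, ins e y.2.1 y.2.2)) ?_ ?_ ?_ ?_ ?_ ?_ ?_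
  · exact F.continuous.comp (continuous_fst.prodMk ((continuous_ins e).comp continuous_snd))
  · intro t z; simp [toPerLoop_apply]
  · intro t z; simp [toPerLoop_apply]
  · intro u z; exact hb _ _ (ins_mem_of_left e z (Or.inl rfl))
  · intro u z; exact hb _ _ (ins_mem_of_left e z (Or.inr rfl))
  · intro u t z z' h
    rcases h.eq_or_mem with h' | h'
    · rw [h']
    · simp only [hb _ _ (ins_mem_of_right e t h'),
        hb _ _ (ins_mem_of_right e t (h.mem_boundary h'))]
  · intro u t z i _ hi; exact hb _ _ (ins_mem_of_right e t ⟨i, hi⟩)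

/-- When every direction lies in `S`, a homotopy of loops of maps takes the value `x` on the whole
boundary of the cube, so it is a homotopy of generalized loops. -/
theorem homotopic_of_toPerLoop (e : N ≃ Option K) {f g : Ω^ N M x}
    (h : (toPerLoop Set.univ e f).Homotopic (toPerLoop Set.univ e g)) : GenLoop.Homotopic f g := by
  obtain ⟨H, hH, h0, h1, hl, hr, -, hS⟩ := PerLoop.exists_of_homotopic h
  have hi : ∀ y : N → I, ins e (y (e.symm none)) (fun k => y (e.symm (some k))) = y := by
    intro y
    funext m
    obtain ⟨o, rfl⟩ := e.symm.surjective m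
    cases o <;> simp [ins]
  have hx : ∀ u, ∀ y ∈ Cube.boundary N,
      H (u, y (e.symm none), fun k => y (e.symm (some k))) = x := by
    rintro u y ⟨m, hm⟩
    obtain ⟨o, rfl⟩ := e.symm.surjective m
    rcases o with _ | k
    · rcases hm with hm | hm <;> rw [hm]
      exacts [hl _ _, hr _ _]
    · exact hS _ _ _ k trivial hm
  refine ⟨⟨⟨⟨fun y => H (y.1, y.2 (e.symm none), fun k => y.2 (e.symm (some k))), by fun_prop⟩,
    fun y => ?_, fun y => ?_⟩, fun u y hy => ?_⟩⟩
  · simp [h0, toPerLoop_apply, hi]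
  · simp [h1, toPerLoop_apply, hi]
  · exact (hx u y hy).trans (f.2 y hy).symm

/-- The class in the torus group of an element of the homotopy group. -/
def toTorus (e : N ≃ Option K) : HomotopyGroup N M x → TorusGroup x K :=
  Quotient.lift (fun f => cls (toPerLoop ∅ e f)) fun _ _ h =>
    cls_eq_iff.2 (toPerLoop_homotopic ∅ e h)

theorem toTorus_mk (e : N ≃ Option K) (f : Ω^ N M x) :
    toTorus e (⟦f⟧ : HomotopyGroup N M x) = cls (toPerLoop ∅ e f) := rfl

/-- The product of a homotopy group may be computed along any coordinate; along `e.symm none` it is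
concatenation of loops, in the same reversed order as in `cls_trans`. -/
theorem toTorus_mul [DecidableEq N] [Nonempty N] (e : N ≃ Option K) (g h : HomotopyGroup N M x) :
    toTorus e (g * h) = toTorus e g * toTorus e h := by
  induction g, h using Quotient.inductionOn₂ with
  | _ f g =>
  refine (congrArg (toTorus e) (HomotopyGroup.mul_spec (i := e.symm none))).trans ?_
  rw [toTorus_mk, toTorus_mk, toTorus_mk, ← cls_trans]
  congr 1
  ext t z
  rw [toPerLoop_apply, Path.trans_apply]
  simp only [GenLoop.transAt, GenLoop.coe_copy]
  have h1 : ins e t z (e.symm none) = t := by simp [ins]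
  have h2 : ∀ s, Function.update (ins e t z) (e.symm none) s = ins e s z := by
    intro s
    funext m
    by_cases hm : m = e.symm none
    · subst hm; simp [ins]
    · rw [Function.update_of_ne hm]
      have : e m ≠ none := fun h => hm (by rw [← h]; simp)
      obtain ⟨k, hk⟩ := Option.ne_none_iff_exists'.1 this
      simp [ins, hk]
  simp only [h1, h2]
  split_ifs with ht
  · rw [toPerLoop_apply]
    congr 2
    exact Set.projIcc_of_mem _ _
  · rw [toPerLoop_apply]
    congr 2
    exact Set.projIcc_of_mem _ _

/-- `toTorus` as a homomorphism. -/
def toTorusHom [DecidableEq N] [Nonempty N] (e : N ≃ Option K) :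
    HomotopyGroup N M x →* TorusGroup x K := MonoidHom.mk' (toTorus e) (toTorus_mul e)

theorem pushHom_toTorus (e : N ≃ Option K) (ρ : K ≃ K') (g : HomotopyGroup N M x) :
    pushHom x ρ (toTorus e g) = toTorus (e.trans (Equiv.optionCongr ρ)) g := by
  induction g using Quotient.inductionOn with
  | _ f =>
  rw [toTorus_mk, toTorus_mk, pushHom_cls]
  congr 1
  ext t z
  rw [toPerLoop_apply, PerLoop.push_apply, toPerLoop_apply]
  congr 1
  funext m
  simp only [ins, Equiv.trans_apply]
  rcases e m with _ | k <;> rfl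

end Whitehead

/-! ### Commuting elements and injectivity of `toTorus` -/

namespace Whitehead

variable {M : Type*} [TopologicalSpace M] {x : M} {K K' N : Type*}

/-- Linear interpolation in the unit interval. -/
def lin (u a b : I) : I :=
  ⟨(1 - u) * a + u * b, by
    have := u.2.1; have := u.2.2; have := a.2.1; have := a.2.2; have := b.2.1; have := b.2.2
    constructor <;> nlinarith⟩

@[simp] theorem lin_zero (a b : I) : lin 0 a b = a := by ext; simp [lin]

@[simp] theorem lin_one (a b : I) : lin 1 a b = b := by ext; simp [lin]

@[simp] theorem lin_self (u a : I) : lin u a a = a := by ext; simp only [lin]; ring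

@[fun_prop]
theorem continuous_lin {X : Type*} [TopologicalSpace X] {u a b : X → I} (hu : Continuous u)
    (ha : Continuous a) (hb : Continuous b) : Continuous fun y => lin (u y) (a y) (b y) := by
  unfold lin
  fun_prop

@[fun_prop]
theorem continuous_clamp {X : Type*} [TopologicalSpace X] {a : X → ℝ} (ha : Continuous a) :
    Continuous fun y => clamp (a y) := continuous_projIcc.comp ha

theorem clamp_of_le {t : ℝ} (h : t ≤ 0) : clamp t = 0 := Set.projIcc_of_le_left zero_le_one h

theorem clamp_of_ge {t : ℝ} (h : 1 ≤ t) : clamp t = 1 := Set.projIcc_of_right_le zero_le_one h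

theorem coe_clamp_of_mem {t : ℝ} (h0 : 0 ≤ t) (h1 : t ≤ 1) : (clamp t : ℝ) = t := by
  rw [clamp, Set.projIcc_of_mem zero_le_one ⟨h0, h1⟩]

theorem clamp_coe (t : I) : clamp (t : ℝ) = t := Set.projIcc_val zero_le_one t

theorem Cong.update [DecidableEq K] {z z' : K → I} (h : Cong z z') {i : K} {s s' : I}
    (hs : s = s' ∨ ((s = 0 ∨ s = 1) ∧ (s' = 0 ∨ s' = 1))) :
    Cong (Function.update z i s) (Function.update z' i s') := by
  intro j
  by_cases hj : j = i
  · subst hj; simpa using hs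
  · simpa [Function.update_of_ne hj] using h j

/-- Reparametrizing one coordinate does not change the homotopy class. -/
theorem PerLoop.homotopic_update [DecidableEq K] {S : Set K} (γ γ' : PerLoop x S) (i : K)
    (κ : I × I → I) (hκ : Continuous κ) (h0 : ∀ u, κ (u, 0) = 0 ∨ κ (u, 0) = 1)
    (h1 : ∀ u, κ (u, 1) = 0 ∨ κ (u, 1) = 1) (hid : ∀ s, κ (0, s) = s)
    (hγ : ∀ t z, (γ' t).1 z = (γ t).1 (Function.update z i (κ (1, z i)))) : γ.Homotopic γ' := by
  have hb : ∀ u s, (s = 0 ∨ s = 1) → κ (u, s) = 0 ∨ κ (u, s) = 1 := by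
    rintro u s (rfl | rfl)
    exacts [h0 u, h1 u]
  refine PerLoop.homotopic_of
    (fun y => (γ y.2.1).1 (Function.update y.2.2 i (κ (y.1, y.2.2 i)))) ?_ ?_ ?_ ?_ ?_ ?_ ?_
  · exact γ.continuous_uncurry.comp
      ((continuous_fst.comp continuous_snd).prodMk
        ((continuous_snd.comp continuous_snd).update i (by fun_prop)))
  · intro t z; simp [hid]
  · intro t z; exact (hγ t z).symm
  · intro u z; simp only [γ.source]; rfl
  · intro u z; simp only [γ.target]; rfl
  · intro u t z z' h
    refine (γ t).2.1 _ _ (h.update ?_)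
    rcases h i with h | h
    · exact Or.inl (by simp only [h])
    · exact Or.inr ⟨hb _ _ h.1, hb _ _ h.2⟩
  · intro u t z j hj hz
    refine (γ t).2.2 _ j hj ?_
    by_cases hji : j = i
    · subst hji; simpa using hb _ _ hz
    · simpa [Function.update_of_ne hji] using hz

/-- Elements of the torus group represented by loops of maps that are constant on the two faces
with direction `i`. -/
def Vanishes (i : K) (g : TorusGroup x K) : Prop :=
  ∃ γ : PerLoop x (∅ : Set K), cls γ = g ∧ ∀ t z, (z i = 0 ∨ z i = 1) → (γ t).1 z = x

/-- An Eckmann–Hilton argument: squeeze one loop into the half `z i ≤ 1/2` and the other into `z i ≥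
1/2`. Their supports no longer interfere, so the two loop parameters can be run independently and in
either order. -/
theorem Vanishes.commute {i : K} {g g' : TorusGroup x K} (hg : Vanishes i g)
    (hg' : Vanishes i g') : Commute g g' := by
  classical
  obtain ⟨γ, rfl, hγ⟩ := hg
  obtain ⟨γ', rfl, hγ'⟩ := hg'
  -- At `u = 1` these stretch the first, respectively the second, half of the interval over all of
  -- it and are constant on the other half.
  let κ : I × I → I := fun y => clamp ((1 + y.1) * y.2)
  let κ' : I × I → I := fun y => clamp ((1 + y.1) * y.2 - y.1)
  have hκ : Continuous κ := by fun_prop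
  have hκ' : Continuous κ' := by fun_prop
  have hκ0 : ∀ u, κ (u, 0) = 0 := fun u => clamp_of_le (by simp)
  have hκ1 : ∀ u, κ (u, 1) = 1 := fun u => clamp_of_ge (by simpa using u.2.1)
  have hκ'0 : ∀ u, κ' (u, 0) = 0 := fun u => clamp_of_le (by simpa using u.2.1)
  have hκ'1 : ∀ u, κ' (u, 1) = 1 := fun u => clamp_of_ge (by simp)
  have hb : ∀ s : I, (s = 0 ∨ s = 1) → κ (1, s) = 0 ∨ κ (1, s) = 1 := by
    rintro s (rfl | rfl)
    exacts [Or.inl (hκ0 1), Or.inr (hκ1 1)]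
  have hb' : ∀ s : I, (s = 0 ∨ s = 1) → κ' (1, s) = 0 ∨ κ' (1, s) = 1 := by
    rintro s (rfl | rfl)
    exacts [Or.inl (hκ'0 1), Or.inr (hκ'1 1)]
  let δ : PerLoop x (∅ : Set K) := PerLoop.mk
    (fun y => (γ y.1).1 (Function.update y.2 i (κ (1, y.2 i))))
    (γ.continuous_uncurry.comp (continuous_fst.prodMk (continuous_snd.update i (by fun_prop))))
    (fun z => by simp only [γ.source]; rfl) (fun z => by simp only [γ.target]; rfl)
    (fun t z z' h => (γ t).2.1 _ _ (h.update ((h i).imp (fun h => by simp only [h])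
      (fun h => ⟨hb _ h.1, hb _ h.2⟩)))) (by simp)
  let δ' : PerLoop x (∅ : Set K) := PerLoop.mk
    (fun y => (γ' y.1).1 (Function.update y.2 i (κ' (1, y.2 i))))
    (γ'.continuous_uncurry.comp (continuous_fst.prodMk (continuous_snd.update i (by fun_prop))))
    (fun z => by simp only [γ'.source]; rfl) (fun z => by simp only [γ'.target]; rfl)
    (fun t z z' h => (γ' t).2.1 _ _ (h.update ((h i).imp (fun h => by simp only [h])
      (fun h => ⟨hb' _ h.1, hb' _ h.2⟩)))) (by simp)
  have hδ : cls γ = cls δ := cls_eq_iff.2 (PerLoop.homotopic_update γ δ i κ hκ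
    (fun u => Or.inl (hκ0 u)) (fun u => Or.inr (hκ1 u)) (fun s => by simp [κ]) fun _ _ => rfl)
  have hδ' : cls γ' = cls δ' := cls_eq_iff.2 (PerLoop.homotopic_update γ' δ' i κ' hκ'
    (fun u => Or.inl (hκ'0 u)) (fun u => Or.inr (hκ'1 u)) (fun s => by simp [κ']) fun _ _ => rfl)
  have hδx : ∀ t z, 1 / 2 ≤ (z i : ℝ) → (δ t).1 z = x := by
    intro t z hz
    refine hγ _ _ (Or.inr ?_)
    simp only [Function.update_self]
    exact clamp_of_ge (by simp; linarith)
  have hδ'x : ∀ t z, (z i : ℝ) ≤ 1 / 2 → (δ' t).1 z = x := by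
    intro t z hz
    refine hγ' _ _ (Or.inl ?_)
    simp only [Function.update_self]
    exact clamp_of_le (by simp; linarith)
  let W : I × I × (K → I) → M := fun y =>
    if (y.2.2 i : ℝ) ≤ 1 / 2 then (δ y.1).1 y.2.2 else (δ' y.2.1).1 y.2.2
  have hW : Continuous W := by
    refine Continuous.if_le ?_ ?_ (by fun_prop) continuous_const ?_
    · exact δ.continuous_uncurry.comp (by fun_prop : Continuous fun y : I × I × (K → I) =>
        (y.1, y.2.2))
    · exact δ'.continuous_uncurry.comp continuous_snd
    · intro y hy
      rw [hδx _ _ hy.ge, hδ'x _ _ hy.le]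
  have hW0 : ∀ s z, W (s, 0, z) = (δ s).1 z := by
    intro s z
    simp only [W]
    split_ifs with h
    · rfl
    · rw [hδx s z (by linarith), δ'.source]; rfl
  have hW0' : ∀ s z, W (0, s, z) = (δ' s).1 z := by
    intro s z
    simp only [W]
    split_ifs with h
    · rw [hδ'x s z h, δ.source]; rfl
    · rfl
  have hW1 : ∀ s z, W (s, 1, z) = (δ s).1 z := by
    intro s z
    simp only [W]
    split_ifs with h
    · rfl
    · rw [hδx s z (by linarith), δ'.target]; rfl
  have hW1' : ∀ s z, W (1, s, z) = (δ' s).1 z := by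
    intro s z
    simp only [W]
    split_ifs with h
    · rw [hδ'x s z h, δ.target]; rfl
    · rfl
  have hWc : ∀ s s' z z', Cong z z' → W (s, s', z) = W (s, s', z') := by
    intro s s' z z' h
    rcases h i with hi | hi
    · simp only [W, hi, (δ s).2.1 z z' h, (δ' s').2.1 z z' h]
    -- Opposite faces in direction `i` fall in different branches of `W`, so periodicity there needs
    -- both branches to equal `x`.
    · have key : ∀ z : K → I, (z i = 0 ∨ z i = 1) → W (s, s', z) = x := by
        intro z hz
        simp only [W]
        rw [show (δ s).1 z = x from hγ _ _ (by simpa using hb _ hz),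
          show (δ' s').1 z = x from hγ' _ _ (by simpa using hb' _ hz), ite_self]
      rw [key z hi.1, key z' hi.2]
  -- The edge path `(A, B)` of the parameter square gives `δ.trans δ'`, the path `(B, A)` gives
  -- `δ'.trans δ`; the square is convex, so they are joined linearly.
  let A : I → I := fun t => clamp (2 * t)
  let B : I → I := fun t => clamp (2 * t - 1)
  have hA : Continuous A := by fun_prop
  have hB : Continuous B := by fun_prop
  have hA0 : A 0 = 0 := clamp_of_le (by simp)
  have hA1 : A 1 = 1 := clamp_of_ge (by norm_num)
  have hB0 : B 0 = 0 := clamp_of_le (by simp)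
  have hB1 : B 1 = 1 := clamp_of_ge (by norm_num)
  have h : (δ.trans δ').Homotopic (δ'.trans δ) := by
    refine PerLoop.homotopic_of
      (fun y => W (lin y.1 (A y.2.1) (B y.2.1), lin y.1 (B y.2.1) (A y.2.1), y.2.2))
      (hW.comp (by fun_prop)) ?_ ?_ ?_ ?_ ?_ (by simp)
    · intro t z
      simp only [lin_zero]
      rw [Path.trans_apply]
      split_ifs with ht
      · rw [show B t = 0 from clamp_of_le (by linarith), hW0]
        congr 3
        exact Set.projIcc_of_mem _ _
      · rw [show A t = 1 from clamp_of_ge (by linarith), hW1']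
        congr 3
        exact Set.projIcc_of_mem _ _
    · intro t z
      simp only [lin_one]
      rw [Path.trans_apply]
      split_ifs with ht
      · rw [show B t = 0 from clamp_of_le (by linarith), hW0']
        congr 3
        exact Set.projIcc_of_mem _ _
      · rw [show A t = 1 from clamp_of_ge (by linarith), hW1]
        congr 3
        exact Set.projIcc_of_mem _ _
    · intro u z
      simp only [hA0, hB0, lin_self, hW0, δ.source]; rfl
    · intro u z
      simp only [hA1, hB1, lin_self, hW1, δ.target]; rfl
    · intro u t z z' h; exact hWc _ _ _ _ h
  have := cls_eq_iff.2 h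
  rw [cls_trans, cls_trans, ← hδ, ← hδ'] at this
  exact this.symm

theorem vanishes_push (φ : K → K') (e : N ≃ Option K) (g : HomotopyGroup N M x) (k : K) :
    Vanishes (φ k) (pushHom x φ (toTorus e g)) := by
  induction g using Quotient.inductionOn with
  | _ f => exact ⟨_, rfl, fun t z hz => f.2 _ (ins_mem_of_right e t ⟨k, hz⟩)⟩

/-- A null-homotopy `H` need not equal `x` on the faces in direction `i`, but it agrees on the two
opposite faces. Insert its trace on a face as a collar at each end. Following `H` in the middle
leaves only the collars, which run along the same trace out and back and therefore cancel. -/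
theorem toPerLoop_insert_homotopic_refl (S : Set K) (i : K) (e : N ≃ Option K) (f : Ω^ N M x)
    (h : (toPerLoop S e f).Homotopic (Path.refl _)) :
    (toPerLoop (insert i S) e f).Homotopic (Path.refl _) := by
  classical
  obtain ⟨H, hH, h0, h1, hl, hr, hc, hS⟩ := PerLoop.exists_of_homotopic h
  replace h1 : ∀ t z, H (1, t, z) = x := h1
  -- `κ` stretches the middle third over the interval, leaving the outer thirds as collars; `T` is
  -- the time in `H`, rising over the first collar, 1 in the middle and falling over the last.
  let T : I → I := fun s => clamp (min (3 * s) (3 - 3 * s))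
  let κ : I → I := fun s => clamp (3 * s - 1)
  have hT : Continuous T := by fun_prop
  have hκ : Continuous κ := by fun_prop
  have hT0 : T 0 = 0 := clamp_of_le (by simp)
  have hT1 : T 1 = 0 := clamp_of_le (by simp)
  have hTb : ∀ s, (s = 0 ∨ s = 1) → T s = 0 := by
    rintro s (rfl | rfl)
    exacts [hT0, hT1]
  have hκ0 : κ 0 = 0 := clamp_of_le (by simp)
  have hκ1 : κ 1 = 1 := clamp_of_ge (by norm_num)
  have hx : ∀ t, ∀ z : K → I, (z i = 0 ∨ z i = 1) → H (0, t, z) = x := fun t z hz => by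
    rw [h0]; exact f.2 _ (ins_mem_of_right e t ⟨i, hz⟩)
  let F : I × I × (K → I) → M := fun y =>
    H (lin y.1 0 (T (y.2.2 i)), y.2.1,
      Function.update y.2.2 i (lin y.1 (y.2.2 i) (κ (y.2.2 i))))
  have hF : Continuous F := hH.comp (Continuous.prodMk (by fun_prop) (Continuous.prodMk
    (by fun_prop) ((continuous_snd.comp continuous_snd).update i (by fun_prop))))
  have hFx : ∀ u t z, (z i = 0 ∨ z i = 1) → F (u, t, z) = x := by
    intro u t z hz
    simp only [F, hTb _ hz, lin_self]
    refine hx _ _ ?_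
    rcases hz with hz | hz <;> simp [hz, hκ0, hκ1]
  have hFc : ∀ u t z z', Cong z z' → F (u, t, z) = F (u, t, z') := by
    intro u t z z' h
    rcases h i with hi | hi
    · simp only [F, hi]
      exact hc _ _ _ _ (h.update (Or.inl rfl))
    · rw [hFx _ _ _ hi.1, hFx _ _ _ hi.2]
  have hFS : ∀ u t z, ∀ j ∈ insert i S, (z j = 0 ∨ z j = 1) → F (u, t, z) = x := by
    intro u t z j hj hz
    by_cases hji : j = i
    · subst hji; exact hFx _ _ _ hz
    · exact hS _ _ _ j (hj.resolve_left hji) (by simpa [Function.update_of_ne hji] using hz)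
  let δ : PerLoop x (insert i S) := PerLoop.mk (fun y => F (1, y)) (hF.comp (by fun_prop))
    (fun z => hl _ _) (fun z => hr _ _) (fun t z z' h => hFc 1 t z z' h) (hFS 1)
  refine Path.Homotopic.trans (p₁ := δ) ?_ ?_
  · refine PerLoop.homotopic_of F hF ?_ (fun _ _ => rfl) (fun _ _ => hl _ _) (fun _ _ => hr _ _)
      hFc hFS
    intro t z
    simp [F, h0, toPerLoop_apply]
  -- The middle third contributes `x`, since `H` has ended there, and the last collar lies on the
  -- face 1, which may be replaced by the face 0. Lowering the time `T` to 0 then contracts the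
  -- loop.
  · have hT' : ∀ t z, F (1, t, z) = H (T (z i), t, Function.update z i 0) := by
      intro t z
      simp only [F, lin_one]
      rcases le_total (z i : ℝ) (1 / 3) with h | h
      · rw [show κ (z i) = 0 from clamp_of_le (by linarith)]
      rcases le_total (2 / 3) (z i : ℝ) with h' | h'
      · rw [show κ (z i) = 1 from clamp_of_ge (by linarith)]
        refine hc _ _ _ _ (Cong.update (fun _ => Or.inl rfl) (Or.inr (by simp)))
      · rw [show T (z i) = 1 from clamp_of_ge (le_min (by linarith) (by linarith)), h1, h1]
    have hTx : ∀ u t z, (z i = 0 ∨ z i = 1) →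
        H (lin u (T (z i)) 0, t, Function.update z i 0) = x := by
      intro u t z hz
      rw [hTb _ hz, lin_self]
      exact hx _ _ (by simp)
    refine PerLoop.homotopic_of (fun y => H (lin y.1 (T (y.2.2 i)) 0, y.2.1,
      Function.update y.2.2 i 0)) ?_ ?_ ?_ (fun _ _ => hl _ _) (fun _ _ => hr _ _) ?_ ?_
    · exact hH.comp (Continuous.prodMk (by fun_prop) (Continuous.prodMk
        (by fun_prop) ((continuous_snd.comp continuous_snd).update i (by fun_prop))))
    · intro t z
      simp only [lin_zero]
      exact (hT' t z).symm
    · intro t z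
      simp only [lin_one]
      exact hx _ _ (by simp)
    · intro u t z z' h
      rcases h i with hi | hi
      · simp only [hi]
        exact hc _ _ _ _ (h.update (Or.inl rfl))
      · simp only [hTx _ _ _ hi.1, hTx _ _ _ hi.2]
    · intro u t z j hj hz
      by_cases hji : j = i
      · subst hji; exact hTx _ _ _ hz
      · exact hS _ _ _ j (hj.resolve_left hji) (by simpa [Function.update_of_ne hji] using hz)

/-- A null-homotopy over the torus is made constant on the faces one direction at a time, until it
is a null-homotopy of generalized loops. -/
theorem toTorusHom_injective [Finite K] [DecidableEq N] [Nonempty N] (e : N ≃ Option K) :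
    Function.Injective (toTorusHom (M := M) (x := x) e) := by
  rw [injective_iff_map_eq_one]
  intro g
  induction g using Quotient.inductionOn with
  | _ f =>
  intro hf
  have h0 : (toPerLoop ∅ e f).Homotopic (Path.refl _) := cls_eq_iff.1 hf
  have h1 : (toPerLoop Set.univ e f).Homotopic (Path.refl _) := by
    induction (Set.univ : Set K), Set.finite_univ (α := K) using Set.Finite.induction_on with
    | empty => exact h0
    | insert _ _ ih => exact toPerLoop_insert_homotopic_refl _ _ e f ih
  refine Quotient.sound (homotopic_of_toPerLoop (g := GenLoop.const) e ?_)
  exact h1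

-- In the Hall–Witt identity the first entry of each outer commutator is conjugated, as in `⁅a * c *
-- a⁻¹, ⁅b, a⁆⁆`. As `a` commutes with `⁅b, a⁆`, this is the conjugate of `⁅c, ⁅b, a⁆⁆` by `a`,
-- which the second commutation makes trivial.
open scoped commutatorElement in
theorem hallWitt_of_commute {G : Type*} [Group G] {a b c : G}
    (ha : Commute a ⁅b, a⁆) (hb : Commute b ⁅c, b⁆) (hc : Commute c ⁅a, c⁆)
    (ha' : Commute a ⁅c, ⁅b, a⁆⁆) (hb' : Commute b ⁅a, ⁅c, b⁆⁆) (hc' : Commute c ⁅b, ⁅a, c⁆⁆) :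
    ⁅c, ⁅b, a⁆⁆ * ⁅a, ⁅c, b⁆⁆ * ⁅b, ⁅a, c⁆⁆ = 1 := by
  have key : ∀ {a c t : G}, Commute a t → Commute a ⁅c, t⁆ → ⁅a * c * a⁻¹, t⁆ = ⁅c, t⁆ := by
    intro a c t h h'
    have := conjugate_commutatorElement c t a
    rwa [h'.eq, mul_inv_cancel_right, h.eq, mul_inv_cancel_right, eq_comm] at this
  have := commutatorElement_conj_commutatorElement_mul a c b
  rwa [key ha ha', key hb hb', key hc hc'] at this

end Whitehead

/-! ### Permutations of the coordinates -/

namespace Whitehead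

variable {M : Type*} [TopologicalSpace M] {x : M} {K K' N : Type*}

/-- Clamping sends points outside the open cube to its boundary, so homotopies may push the cube
beyond itself. -/
theorem GenLoop.homotopic_of_clamp {f g h : Ω^ N M x} (Φ : I × (N → I) → N → ℝ)
    (hΦ : Continuous Φ)
    (hb : ∀ u, ∀ y ∈ Cube.boundary N, ∃ m, Φ (u, y) m ≤ 0 ∨ 1 ≤ Φ (u, y) m)
    (hg : ∀ y, g y = f fun m => clamp (Φ (0, y) m))
    (hh : ∀ y, h y = f fun m => clamp (Φ (1, y) m)) : GenLoop.Homotopic g h := by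
  refine ⟨⟨⟨⟨fun y => f fun m => clamp (Φ y m), ?_⟩, fun y => (hg y).symm, fun y => (hh y).symm⟩,
    fun u y hy => ?_⟩⟩
  · exact f.1.continuous.comp (by fun_prop)
  · refine (f.2 _ ?_).trans (g.2 y hy).symm
    obtain ⟨m, hm⟩ := hb u y hy
    exact ⟨m, hm.imp clamp_of_le clamp_of_ge⟩

/-- The linear path between the swap and the reflection of one coordinate passes through scaled
reflections, which can shrink the square. The factor `1 + 8u(1 - u)`, equal to 1 at both ends, keeps
the image of the boundary outside the open square. -/
theorem half_le_abs_of_reflection {u a b : ℝ} (hu0 : 0 ≤ u) (hu1 : u ≤ 1) (ha : |a| ≤ 1 / 2)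
    (hb : |b| ≤ 1 / 2) (h : |a| = 1 / 2 ∨ |b| = 1 / 2) :
    1 / 2 ≤ |(1 + 8 * u * (1 - u)) * ((1 - u) * b - u * a)| ∨
      1 / 2 ≤ |(1 + 8 * u * (1 - u)) * ((1 - u) * a + u * b)| := by
  have hc : 1 ≤ 1 + 8 * u * (1 - u) := by nlinarith
  set c := 1 + 8 * u * (1 - u) with hcdef
  -- Near either end one coefficient dominates, and the bound reduces to `c(1 - 2v) ≥ 1`, which
  -- holds for `v ≤ 3/10`.
  have key : ∀ {v p q : ℝ}, 0 ≤ v → v ≤ 3 / 10 → 1 + 8 * v * (1 - v) = c → |p| = 1 / 2 →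
      |q| ≤ 1 / 2 → 1 / 2 ≤ |c * ((1 - v) * p + v * q)| := by
    intro v p q hv hv' hvc hp hq
    rw [abs_mul, abs_of_nonneg (by linarith)]
    have h1 : (1 - v) * (1 / 2) - v * (1 / 2) ≤ |(1 - v) * p + v * q| := by
      have h2 : |(1 - v) * p| - |v * q| ≤ |(1 - v) * p + v * q| := by
        have := abs_sub_abs_le_abs_sub ((1 - v) * p) (-(v * q))
        rwa [abs_neg, sub_neg_eq_add] at this
      rw [abs_mul, abs_mul, abs_of_nonneg hv, abs_of_nonneg (by linarith : 0 ≤ 1 - v), hp] at h2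
      nlinarith
    have h3 : 1 ≤ c * (1 - 2 * v) := by
      rw [← hvc]
      nlinarith [mul_nonneg hv (sq_nonneg v), mul_nonneg hv (by nlinarith : 0 ≤ 6 - 24 * v + 16 * v ^ 2)]
    nlinarith
  have hneg : |(-a)| ≤ 1 / 2 := by rwa [abs_neg]
  rcases le_total u (3 / 10) with h1 | h1
  · rcases h with h | h
    · exact Or.inr (key hu0 h1 hcdef.symm h hb)
    · have := key hu0 h1 hcdef.symm h hneg
      exact Or.inl (by convert this using 3; ring)
  rcases le_total (7 / 10) u with h2 | h2
  · have hcc : 1 + 8 * (1 - u) * (1 - (1 - u)) = c := by rw [hcdef]; ring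
    rcases h with h | h
    · have := key (v := 1 - u) (by linarith) (by linarith) hcc ((abs_neg a).trans h) hb
      exact Or.inl (by convert this using 3; ring)
    · have := key (v := 1 - u) (by linarith) (by linarith) hcc h ha
      exact Or.inr (by convert this using 3; ring)
  -- In the middle range compare Euclidean norms: the squared norm is at least `4 · (1/2) · (1/4) =
  -- 1/2`, so the two coordinates cannot both be below `1/2` in absolute value.
  · by_contra! hcon
    have h3 := sq_lt_sq' (by linarith [abs_nonneg (c * ((1 - u) * b - u * a))]) hcon.1
    have h4 := sq_lt_sq' (by linarith [abs_nonneg (c * ((1 - u) * a + u * b))]) hcon.2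
    rw [sq_abs] at h3 h4
    have h5 : 1 / 4 ≤ a ^ 2 + b ^ 2 := by
      rcases h with h | h
      · have := sq_abs a; rw [h] at this; nlinarith [sq_nonneg b]
      · have := sq_abs b; rw [h] at this; nlinarith [sq_nonneg a]
    have h6 : 2 ≤ c := by nlinarith
    have h7 : 1 / 2 ≤ (1 - u) ^ 2 + u ^ 2 := by nlinarith [sq_nonneg (1 - 2 * u)]
    have h8 : c ^ 2 * (((1 - u) ^ 2 + u ^ 2) * (a ^ 2 + b ^ 2)) < 1 / 2 := by nlinarith
    have h9 : 1 / 8 ≤ ((1 - u) ^ 2 + u ^ 2) * (a ^ 2 + b ^ 2) := by nlinarith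
    nlinarith

/-- Both are reflections of the square in the directions `i`, `j`, so they are joined by linear maps
of negative determinant about the centre of the square. -/
theorem GenLoop.congr_swap_homotopic [DecidableEq N] {i j : N} (hij : i ≠ j) (f : Ω^ N M x) :
    GenLoop.Homotopic (GenLoop.congr x (Equiv.swap i j) f) (GenLoop.symmAt i f) := by
  let c : I → ℝ := fun u => 1 + 8 * u * (1 - u)
  let Φ : I × (N → I) → N → ℝ := fun y m =>
    if m = i then 1 / 2 + c y.1 * ((1 - y.1) * (y.2 j - 1 / 2) - y.1 * (y.2 i - 1 / 2))
    else if m = j then 1 / 2 + c y.1 * ((1 - y.1) * (y.2 i - 1 / 2) + y.1 * (y.2 j - 1 / 2))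
    else y.2 m
  have hΦ : Continuous Φ := by
    refine continuous_pi fun m => ?_
    simp only [Φ, c]
    split_ifs <;> fun_prop
  refine GenLoop.homotopic_of_clamp (f := f) Φ hΦ ?_ ?_ ?_
  · intro u y hy
    by_cases hm : ∃ m, m ≠ i ∧ m ≠ j ∧ (y m = 0 ∨ y m = 1)
    · obtain ⟨m, hi, hj, hm⟩ := hm
      refine ⟨m, ?_⟩
      simp only [Φ, if_neg hi, if_neg hj]
      rcases hm with hm | hm <;> simp [hm]
    have hab : ∀ s : I, |(s : ℝ) - 1 / 2| ≤ 1 / 2 := fun s => by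
      rw [abs_le]; constructor <;> linarith [s.2.1, s.2.2]
    have hab' : ∀ s : I, (s = 0 ∨ s = 1) → |(s : ℝ) - 1 / 2| = 1 / 2 := by
      rintro s (rfl | rfl) <;> norm_num [abs_of_pos, abs_of_neg]
    have hor : |(y i : ℝ) - 1 / 2| = 1 / 2 ∨ |(y j : ℝ) - 1 / 2| = 1 / 2 := by
      obtain ⟨m, h⟩ := hy
      by_cases hi : m = i
      · subst hi; exact Or.inl (hab' _ h)
      by_cases hj : m = j
      · subst hj; exact Or.inr (hab' _ h)
      exact absurd ⟨m, hi, hj, h⟩ hm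
    have hout : ∀ r : ℝ, 1 / 2 ≤ |r| → 1 / 2 + r ≤ 0 ∨ 1 ≤ 1 / 2 + r := by
      intro r hr
      rcases le_abs.1 hr with h | h
      · exact Or.inr (by linarith)
      · exact Or.inl (by linarith)
    rcases half_le_abs_of_reflection u.2.1 u.2.2 (hab (y i)) (hab (y j)) hor with h | h
    · exact ⟨i, by simpa only [Φ, if_true] using hout _ h⟩
    · exact ⟨j, by simpa only [Φ, if_true, if_neg hij.symm] using hout _ h⟩
  · intro y
    refine congrArg f (funext fun m => ?_)
    simp only [Φ, c]
    by_cases hi : m = i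
    · subst hi; simp
    by_cases hj : m = j
    · subst hj; simp [hi]
    simp [hi, hj, Equiv.swap_apply_of_ne_of_ne hi hj]
  · intro y
    refine congrArg f (funext fun m => ?_)
    simp only [Φ, c]
    by_cases hi : m = i
    · subst hi
      simp only [if_true]
      refine (clamp_coe _).symm.trans (congrArg clamp ?_)
      simp; ring
    by_cases hj : m = j
    · subst hj; simp [hi]
    simp [hi, hj]

/-- The action of permutations of the coordinates on the homotopy group. -/
def permAct (τ : Equiv.Perm N) : HomotopyGroup N M x → HomotopyGroup N M x :=
  Quotient.map (GenLoop.congr x τ) fun f g ⟨F⟩ => by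
    refine ⟨⟨⟨⟨fun y => F (y.1, fun m => y.2 (τ m)), by fun_prop⟩, fun y => ?_, fun y => ?_⟩,
      fun u y hy => ?_⟩⟩
    · exact F.apply_zero _
    · exact F.apply_one _
    · obtain ⟨m, hm⟩ := hy
      exact F.eq_fst u ⟨τ.symm m, by simpa using hm⟩

theorem permAct_mul (τ ρ : Equiv.Perm N) (g : HomotopyGroup N M x) :
    permAct (τ * ρ) g = permAct τ (permAct ρ g) := by
  induction g using Quotient.inductionOn with
  | _ f => rfl

theorem permAct_eq_zpow_sign [DecidableEq N] [Fintype N] [Nontrivial N] (τ : Equiv.Perm N)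
    (g : HomotopyGroup N M x) : permAct τ g = g ^ (Equiv.Perm.sign τ : ℤ) := by
  induction τ using Equiv.Perm.swap_induction_on with
  | one =>
    simp only [map_one, Units.val_one, zpow_one]
    induction g using Quotient.inductionOn with
    | _ f => rfl
  | swap_mul τ i j hij ih =>
    have h : ∀ h : HomotopyGroup N M x, permAct (Equiv.swap i j) h = h⁻¹ := by
      intro h
      induction h using Quotient.inductionOn with
      | _ f =>
      exact (Quotient.sound (GenLoop.congr_swap_homotopic hij f)).trans
        (HomotopyGroup.inv_spec (i := i)).symm
    rw [permAct_mul, ih, h, map_mul, Equiv.Perm.sign_swap hij]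
    simp

theorem toTorus_trans [DecidableEq N] [Fintype N] [Nontrivial N] (τ : Equiv.Perm N)
    (e : N ≃ Option K) (g : HomotopyGroup N M x) :
    toTorus (τ.trans e) g = toTorus e g ^ (Equiv.Perm.sign τ : ℤ) := by
  have h : toTorus (τ.trans e) g = toTorus e (permAct τ g) := by
    induction g using Quotient.inductionOn with
    | _ f => rfl
  rw [h, permAct_eq_zpow_sign]
  exact map_zpow (toTorusHom e) g _

end Whitehead

/-! ### The Whitehead product as a commutator -/

namespace Whitehead

variable {M : Type*} [TopologicalSpace M] {x : M} {K K' N : Type*}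

/-! ### The loop around the boundary of a square -/

/-- The first coordinate of the loop `collapseFun` around the boundary of the square. -/
def sqFst (t : I) : I := clamp (2 - 6 * |(t : ℝ) - 1 / 2|)

/-- The second coordinate of the loop `collapseFun` around the boundary of the square. -/
def sqSnd (t : I) : I := clamp (3 - 6 * |(t : ℝ) - 1 / 2|) * clamp (3 * t - 1)

@[fun_prop]
theorem continuous_sqFst : Continuous sqFst := by unfold sqFst; fun_prop

@[fun_prop]
theorem continuous_sqSnd : Continuous sqSnd := by unfold sqSnd; fun_prop

theorem sq_of_le_sixth {t : I} (h : (t : ℝ) ≤ 1 / 6) : sqFst t = 0 ∧ sqSnd t = 0 := by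
  have h1 : |(t : ℝ) - 1 / 2| = 1 / 2 - t := by rw [abs_of_nonpos] <;> linarith
  constructor
  · exact clamp_of_le (by rw [h1]; linarith)
  · rw [sqSnd, clamp_of_le (t := 3 * t - 1) (by linarith), mul_zero]

theorem sq_bottom {t : I} (h : 1 / 6 ≤ (t : ℝ)) (h' : (t : ℝ) ≤ 1 / 3) :
    (sqFst t : ℝ) = 6 * t - 1 ∧ sqSnd t = 0 := by
  have h1 : |(t : ℝ) - 1 / 2| = 1 / 2 - t := by rw [abs_of_nonpos] <;> linarith
  constructor
  · rw [sqFst, h1, coe_clamp_of_mem] <;> linarith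
  · rw [sqSnd, clamp_of_le (t := 3 * t - 1) (by linarith), mul_zero]

theorem sq_right {t : I} (h : 1 / 3 ≤ (t : ℝ)) (h' : (t : ℝ) ≤ 2 / 3) :
    sqFst t = 1 ∧ (sqSnd t : ℝ) = 3 * t - 1 := by
  have h1 : |(t : ℝ) - 1 / 2| ≤ 1 / 6 := abs_le.2 ⟨by linarith, by linarith⟩
  constructor
  · exact clamp_of_ge (by linarith)
  · rw [sqSnd, clamp_of_ge (t := 3 - 6 * |(t : ℝ) - 1 / 2|) (by linarith), one_mul,
      coe_clamp_of_mem] <;> linarith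

theorem sq_top {t : I} (h : 2 / 3 ≤ (t : ℝ)) (h' : (t : ℝ) ≤ 5 / 6) :
    (sqFst t : ℝ) = 5 - 6 * t ∧ sqSnd t = 1 := by
  have h1 : |(t : ℝ) - 1 / 2| = t - 1 / 2 := by rw [abs_of_nonneg]; linarith
  constructor
  · rw [sqFst, h1, coe_clamp_of_mem] <;> linarith
  · rw [sqSnd, h1, clamp_of_ge (by linarith), clamp_of_ge (by linarith), one_mul]

theorem sq_left {t : I} (h : 5 / 6 ≤ (t : ℝ)) :
    sqFst t = 0 ∧ (sqSnd t : ℝ) = 6 - 6 * t := by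
  have h1 : |(t : ℝ) - 1 / 2| = t - 1 / 2 := by rw [abs_of_nonneg]; linarith
  have := t.2.2
  constructor
  · exact clamp_of_le (by rw [h1]; linarith)
  · rw [sqSnd, h1, clamp_of_ge (t := 3 * t - 1) (by linarith), mul_one, coe_clamp_of_mem] <;>
      linarith

theorem sq_mem (t : I) : sqFst t = 0 ∨ sqFst t = 1 ∨ sqSnd t = 0 ∨ sqSnd t = 1 := by
  rcases le_total (t : ℝ) (1 / 6) with h | h
  · exact Or.inl (sq_of_le_sixth h).1
  rcases le_total (t : ℝ) (1 / 3) with h' | h'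
  · exact Or.inr (Or.inr (Or.inl (sq_bottom h h').2))
  rcases le_total (t : ℝ) (2 / 3) with h | h
  · exact Or.inr (Or.inl (sq_right h' h).1)
  rcases le_total (t : ℝ) (5 / 6) with h' | h'
  · exact Or.inr (Or.inr (Or.inr (sq_top h h').2))
  · exact Or.inl (sq_left h').1

/-- A loop that runs along `P` and `R` as the coordinates run around the square is homotopic to
the commutator of `P` and `R`. -/
theorem homotopic_commutator {X : Type*} [TopologicalSpace X] {o : X} (P R Q : Path o o)
    (hP : ∀ t, (sqSnd t = 0 ∨ sqSnd t = 1) → Q t = P (sqFst t))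
    (hR : ∀ t, (sqFst t = 0 ∨ sqFst t = 1) → Q t = R (sqSnd t)) :
    Q.Homotopic ((P.trans R).trans (P.symm.trans R.symm)) := by
  -- Sends the four quarters of the interval, on which the concatenation runs through its four
  -- factors, affinely to the intervals of the four sides, with endpoints 1/6, 1/3, 2/3, 5/6, 1.
  let θ : I → I := fun t =>
    clamp (1 / 6 + 2 / 3 * t + 2 / 3 * (min (t : ℝ) (1 / 2) - min (t : ℝ) (1 / 4)))
  have hθ : Continuous θ := by fun_prop
  have θ1 : ∀ t : I, (t : ℝ) ≤ 1 / 4 → (θ t : ℝ) = 1 / 6 + 2 / 3 * t := by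
    intro t ht
    have := t.2.1
    simp only [θ]
    rw [min_eq_left (by linarith), min_eq_left ht, coe_clamp_of_mem] <;> linarith
  have θ2 : ∀ t : I, 1 / 4 ≤ (t : ℝ) → (t : ℝ) ≤ 1 / 2 → (θ t : ℝ) = 4 / 3 * t := by
    intro t ht ht'
    simp only [θ]
    rw [min_eq_left ht', min_eq_right ht, coe_clamp_of_mem] <;> linarith
  have θ3 : ∀ t : I, 1 / 2 ≤ (t : ℝ) → (θ t : ℝ) = 1 / 3 + 2 / 3 * t := by
    intro t ht
    have := t.2.2
    simp only [θ]
    rw [min_eq_right ht, min_eq_right (by linarith), coe_clamp_of_mem] <;> linarith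
  have hθ1 : θ 1 = 1 := by
    apply Subtype.ext
    rw [θ3 1 (by norm_num)]; norm_num
  have hend : ∀ t, Q (θ t) = (P.trans R).trans (P.symm.trans R.symm) t := by
    intro t
    rw [Path.trans_apply]
    split_ifs with h
    · rw [Path.trans_apply]
      split_ifs with h'
      · have h' : (t : ℝ) ≤ 1 / 4 := by simp only at h'; linarith
        have e := θ1 t h'
        have := sq_bottom (t := θ t) (by rw [e]; linarith [t.2.1]) (by rw [e]; linarith)
        rw [hP _ (Or.inl this.2)]
        congr 1
        apply Subtype.ext
        simp only [this.1, e]; ring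
      · have h' : 1 / 4 ≤ (t : ℝ) := by simp only at h'; linarith
        have e := θ2 t h' h
        have := sq_right (t := θ t) (by rw [e]; linarith) (by rw [e]; linarith)
        rw [hR _ (Or.inr this.1)]
        congr 1
        apply Subtype.ext
        simp only [this.2, e]; ring
    · have e := θ3 t (by linarith)
      rw [Path.trans_apply]
      split_ifs with h'
      · have h' : (t : ℝ) ≤ 3 / 4 := by simp only at h'; linarith
        have := sq_top (t := θ t) (by rw [e]; linarith) (by rw [e]; linarith)
        rw [hP _ (Or.inr this.2), Path.symm_apply]
        congr 1
        apply Subtype.ext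
        simp only [this.1, e, unitInterval.coe_symm_eq]; ring
      · have h' : 3 / 4 ≤ (t : ℝ) := by simp only at h'; linarith
        have := sq_left (t := θ t) (by rw [e]; linarith)
        rw [hR _ (Or.inl this.1), Path.symm_apply]
        congr 1
        apply Subtype.ext
        simp only [this.2, e, unitInterval.coe_symm_eq]; ring
  refine ⟨⟨⟨⟨fun y => Q (lin y.1 y.2 (θ y.2)), by fun_prop⟩, fun t => by simp, fun t => ?_⟩, ?_⟩⟩
  · simp [hend]
  · rintro u t (rfl | ht)
    -- `θ` starts at `1/6`, not at 0; the base point stays fixed because the square loop rests at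
    -- its vertex on `[0, 1/6]`.
    · have h : (lin u 0 (θ 0) : ℝ) ≤ 1 / 6 := by
        have := θ1 0 (by norm_num)
        simp only [lin, this]
        have := u.2.2
        simp; linarith
      have h := sq_of_le_sixth h
      simp only [ContinuousMap.coe_mk]
      rw [hR _ (Or.inl h.1), h.2]
      simp
    · rw [Set.mem_singleton_iff.1 ht]
      simp [hθ1]

/-! ### Straight-line homotopies in the boundary of a product of cubes -/

variable {a b n : ℕ}

/-- Coordinates `(t, t', w)` of the product of the cubes `I^(a+1)` and `I^(b+1)`, with the first
coordinate of each factor listed separately. -/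
abbrev Coord (a b : ℕ) := I × I × (Fin a ⊕ Fin b → I)

/-- The point of the product with given coordinates. -/
def Coord.point (c : Coord a b) : (I^(Fin (a + 1))) × (I^(Fin (b + 1))) :=
  (Fin.cons c.1 fun i => c.2.2 (Sum.inl i), Fin.cons c.2.1 fun j => c.2.2 (Sum.inr j))

theorem Coord.continuous_point : Continuous (Coord.point (a := a) (b := b)) := by
  unfold Coord.point
  refine Continuous.prodMk (continuous_pi fun i => ?_) (continuous_pi fun i => ?_)
  all_goals
    refine Fin.cases ?_ (fun i => ?_) i
    · simp only [Fin.cons_zero]; fun_prop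
    · simp only [Fin.cons_succ]; fun_prop

/-- The points with these coordinates lie on a common face of the product. -/
def Coord.Common (c c' : Coord a b) : Prop :=
  (c.1 = c'.1 ∧ (c.1 = 0 ∨ c.1 = 1)) ∨ (c.2.1 = c'.2.1 ∧ (c.2.1 = 0 ∨ c.2.1 = 1)) ∨
    ∃ k, c.2.2 k = c'.2.2 k ∧ (c.2.2 k = 0 ∨ c.2.2 k = 1)

theorem Coord.Common.point_mem {c : Coord a b} (h : Coord.Common c c) :
    c.point ∈ sphere (a + 1) (b + 1) := by
  rcases h with h | h | ⟨i | j, h⟩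
  · exact Or.inl ⟨0, h.2⟩
  · exact Or.inr ⟨0, h.2⟩
  · exact Or.inl ⟨i.succ, h.2⟩
  · exact Or.inr ⟨j.succ, h.2⟩

/-- Linear interpolation of coordinates. -/
def Coord.mix (u : I) (c c' : Coord a b) : Coord a b :=
  (lin u c.1 c'.1, lin u c.2.1 c'.2.1, fun k => lin u (c.2.2 k) (c'.2.2 k))

/-- Faces are convex, so the segment between two points of a common face stays in the boundary
sphere. -/
theorem Coord.Common.mix {c c' : Coord a b} (h : Coord.Common c c') (u : I) :
    Coord.Common (Coord.mix u c c') (Coord.mix u c c') := by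
  rcases h with h | h | ⟨k, h⟩
  · exact Or.inl ⟨rfl, by simpa [Coord.mix, ← h.1] using h.2⟩
  · exact Or.inr (Or.inl ⟨rfl, by simpa [Coord.mix, ← h.1] using h.2⟩)
  · exact Or.inr (Or.inr ⟨k, rfl, by simpa [Coord.mix, ← h.1] using h.2⟩)

open Classical in
/-- The value of `attach f g` in coordinates. -/
def attachAt (f : Ω^ (Fin (a + 1)) M x) (g : Ω^ (Fin (b + 1)) M x) (c : Coord a b) : M :=
  if c.point.1 ∈ Cube.boundary (Fin (a + 1)) then g c.point.2 else f c.point.1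

variable (f : Ω^ (Fin (a + 1)) M x) (g : Ω^ (Fin (b + 1)) M x)

theorem continuous_attachAt {X : Type*} [TopologicalSpace X] {Φ : X → Coord a b}
    (hΦ : Continuous Φ) (h : ∀ y, Coord.Common (Φ y) (Φ y)) :
    Continuous fun y => attachAt f g (Φ y) :=
  (attach f g).continuous.comp
    ((Coord.continuous_point.comp hΦ).subtype_mk fun y => (h y).point_mem)

theorem attachAt_of_fst {c : Coord a b} (h : c.1 = 0 ∨ c.1 = 1) :
    attachAt f g c = g c.point.2 := if_pos ⟨0, h⟩

theorem attachAt_of_snd {c : Coord a b} (h : c.2.1 = 0 ∨ c.2.1 = 1) :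
    attachAt f g c = f c.point.1 := by
  unfold attachAt
  split_ifs with h'
  · exact (g.2 _ ⟨0, h⟩).trans (f.2 _ h').symm
  · rfl

theorem attachAt_zero {c : Coord a b} (h : c.1 = 0) (h' : c.2.1 = 0) : attachAt f g c = x :=
  (attachAt_of_fst f g (Or.inl h)).trans (g.2 _ ⟨0, Or.inl h'⟩)

theorem attachAt_cong {c c' : Coord a b} (h : c.1 = c'.1) (h' : c.2.1 = c'.2.1)
    (hc : Cong c.2.2 c'.2.2) : attachAt f g c = attachAt f g c' := by
  have h1 : Cong c.point.1 c'.point.1 := fun i => by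
    refine Fin.cases ?_ (fun i => ?_) i
    · exact Or.inl h
    · exact hc (Sum.inl i)
  have h2 : Cong c.point.2 c'.point.2 := fun i => by
    refine Fin.cases ?_ (fun i => ?_) i
    · exact Or.inl h'
    · exact hc (Sum.inr i)
  classical
  exact if_congr ⟨h1.mem_boundary, h1.symm.mem_boundary⟩ (GenLoop.apply_eq_of_cong g h2)
    (GenLoop.apply_eq_of_cong f h1)

/-- A loop of maps given in coordinates. -/
def attachLoop (Φ : I × (Fin a ⊕ Fin b → I) → Coord a b) (hΦ : Continuous Φ)
    (h : ∀ y, Coord.Common (Φ y) (Φ y))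
    (h0 : ∀ t z, (t = 0 ∨ t = 1) → (Φ (t, z)).1 = 0 ∧ (Φ (t, z)).2.1 = 0)
    (hc : ∀ t z z', Cong z z' → attachAt f g (Φ (t, z)) = attachAt f g (Φ (t, z'))) :
    PerLoop x (∅ : Set (Fin a ⊕ Fin b)) :=
  PerLoop.mk (fun y => attachAt f g (Φ y)) (continuous_attachAt f g hΦ h)
    (fun z => attachAt_zero f g (h0 0 z (Or.inl rfl)).1 (h0 0 z (Or.inl rfl)).2)
    (fun z => attachAt_zero f g (h0 1 z (Or.inr rfl)).1 (h0 1 z (Or.inr rfl)).2) hc (by simp)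

theorem attachLoop_homotopic {γ γ' : PerLoop x (∅ : Set (Fin a ⊕ Fin b))}
    (Φ Ψ : I × (Fin a ⊕ Fin b → I) → Coord a b) (hΦ : Continuous Φ) (hΨ : Continuous Ψ)
    (h : ∀ y, Coord.Common (Φ y) (Ψ y))
    (h0 : ∀ t z, (t = 0 ∨ t = 1) → (Φ (t, z)).1 = 0 ∧ (Φ (t, z)).2.1 = 0)
    (h0' : ∀ t z, (t = 0 ∨ t = 1) → (Ψ (t, z)).1 = 0 ∧ (Ψ (t, z)).2.1 = 0)
    (hc : ∀ u t z z', Cong z z' → attachAt f g (Coord.mix u (Φ (t, z)) (Ψ (t, z))) =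
      attachAt f g (Coord.mix u (Φ (t, z')) (Ψ (t, z'))))
    (hγ : ∀ t z, (γ t).1 z = attachAt f g (Φ (t, z)))
    (hγ' : ∀ t z, (γ' t).1 z = attachAt f g (Ψ (t, z))) : γ.Homotopic γ' := by
  have hx : ∀ u t z, (t = 0 ∨ t = 1) →
      attachAt f g (Coord.mix u (Φ (t, z)) (Ψ (t, z))) = x := by
    intro u t z ht
    refine attachAt_zero f g ?_ ?_
    · simp [Coord.mix, h0 t z ht, h0' t z ht]
    · simp [Coord.mix, h0 t z ht, h0' t z ht]
  refine PerLoop.homotopic_of (fun y => attachAt f g (Coord.mix y.1 (Φ y.2) (Ψ y.2)))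
    (continuous_attachAt f g (by unfold Coord.mix; fun_prop) fun y => (h y.2).mix y.1)
    (fun t z => ?_) (fun t z => ?_) (fun u z => hx u 0 z (Or.inl rfl))
    (fun u z => hx u 1 z (Or.inr rfl)) hc (by simp)
  · simp [hγ, Coord.mix]
  · simp [hγ', Coord.mix]

/-- The sup-distance from the centre of the cube `I^K`. -/
def cubeRadius [Fintype K] (z : K → I) : ℝ := dist (fun i => (z i : ℝ)) fun _ => 1 / 2

theorem continuous_cubeRadius [Fintype K] : Continuous (cubeRadius (K := K)) := by
  unfold cubeRadius; fun_prop

theorem abs_le_cubeRadius [Fintype K] (z : K → I) (k : K) :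
    |(z k : ℝ) - 1 / 2| ≤ cubeRadius z :=
  dist_le_pi_dist (fun i => (z i : ℝ)) (fun _ => 1 / 2) k

theorem abs_sub_half_of_endpoint {s : I} (h : s = 0 ∨ s = 1) : |(s : ℝ) - 1 / 2| = 1 / 2 := by
  rcases h with rfl | rfl <;> norm_num [abs_of_pos, abs_of_neg]

theorem Cong.cubeRadius_eq [Fintype K] {z z' : K → I} (h : Cong z z') :
    cubeRadius z = cubeRadius z' := by
  have : ∀ i, dist (z i : ℝ) (1 / 2) = dist (z' i : ℝ) (1 / 2) := by
    intro i
    rcases h i with h | h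
    · rw [h]
    · rw [Real.dist_eq, Real.dist_eq, abs_sub_half_of_endpoint h.1, abs_sub_half_of_endpoint h.2]
  refine le_antisymm ?_ ?_
  · exact (dist_pi_le_iff dist_nonneg).2 fun i => (this i).le.trans (abs_le_cubeRadius z' i)
  · exact (dist_pi_le_iff dist_nonneg).2 fun i => (this i).ge.trans (abs_le_cubeRadius z i)

theorem half_le_cubeRadius [Fintype K] {z : K → I} (h : z ∈ Cube.boundary K) :
    1 / 2 ≤ cubeRadius z := by
  obtain ⟨i, hi⟩ := h
  exact (abs_sub_half_of_endpoint hi).ge.trans (abs_le_cubeRadius z i)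

theorem clamp_eq_of_lt_abs {s : I} (h : 1 / 6 < |(s : ℝ) - 1 / 2|) :
    clamp (3 * s - 1) = 0 ∨ clamp (3 * s - 1) = 1 := by
  rcases lt_abs.1 h with h | h
  · exact Or.inr (clamp_of_ge (by linarith))
  · exact Or.inl (clamp_of_le (by linarith))

theorem exists_clamp_eq_of_lt_cubeRadius [Fintype K] {z : K → I} (h : 1 / 6 < cubeRadius z) :
    ∃ k, clamp (3 * z k - 1) = 0 ∨ clamp (3 * z k - 1) = 1 := by
  by_contra! hc
  refine absurd h (not_lt.2 ((dist_pi_le_iff (by norm_num)).2 fun i => ?_))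
  by_contra! hi
  rcases clamp_eq_of_lt_abs hi with h | h
  exacts [(hc i).1 h, (hc i).2 h]

theorem radius_ins [Fintype K] (e : Fin n ≃ Option K) (t : I) (z : K → I) :
    radius (ins e t z) = max |(t : ℝ) - 1 / 2| (cubeRadius z) := by
  refine le_antisymm ((dist_pi_le_iff (le_max_of_le_left (abs_nonneg _))).2 fun m => ?_)
    (max_le ?_ ((dist_pi_le_iff dist_nonneg).2 fun k => ?_))
  · unfold ins
    rcases e m with _ | k
    · exact le_max_left _ _
    · exact le_max_of_le_right (abs_le_cubeRadius z k)
  · have := dist_le_pi_dist (fun m => (ins e t z m : ℝ)) (fun _ => 1 / 2) (e.symm none)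
    simpa [ins, Real.dist_eq, radius] using this
  · have := dist_le_pi_dist (fun m => (ins e t z m : ℝ)) (fun _ => 1 / 2) (e.symm (some k))
    simpa [ins, Real.dist_eq, radius] using this

/-- `collapseFun` prepends a coordinate, so coordinate `m` of `I^n` becomes coordinate `m + 1`. Thus
the loop coordinate, at index `a`, becomes the first coordinate of the second factor, and the new
one is the first coordinate of the first. -/
theorem loop_ins (h : n + 1 = a + 1 + (b + 1)) (e : Fin n ≃ Option (Fin a ⊕ Fin b))
    (he1 : ∀ (m : Fin n) (i : Fin a), (m : ℕ) = i → e m = some (Sum.inl i))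
    (he0 : ∀ m : Fin n, (m : ℕ) = a → e m = none)
    (he2 : ∀ (m : Fin n) (j : Fin b), (m : ℕ) = a + 1 + j → e m = some (Sum.inr j))
    (t : I) (z : Fin a ⊕ Fin b → I) :
    loop (Nat.le_add_left 1 a) (Nat.le_add_left 1 b) h f g (ins e t z) = attachAt f g
      (clamp (2 - 6 * max |(t : ℝ) - 1 / 2| (cubeRadius z)),
        clamp (3 - 6 * max |(t : ℝ) - 1 / 2| (cubeRadius z)) * clamp (3 * t - 1),
        fun k => clamp (3 - 6 * max |(t : ℝ) - 1 / 2| (cubeRadius z)) * clamp (3 * z k - 1)) := by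
  have hp : (collapse h (ins e t z)).1 = Coord.point
      (clamp (2 - 6 * max |(t : ℝ) - 1 / 2| (cubeRadius z)),
        clamp (3 - 6 * max |(t : ℝ) - 1 / 2| (cubeRadius z)) * clamp (3 * t - 1),
        fun k => clamp (3 - 6 * max |(t : ℝ) - 1 / 2| (cubeRadius z)) * clamp (3 * z k - 1)) := by
    simp only [← radius_ins e]
    have hs : ∀ (l : Fin (n + 1)) (m : Fin n), (l : ℕ) = m + 1 → collapseFun (ins e t z) l =
        clamp (3 - 6 * radius (ins e t z)) * clamp (3 * ins e t z m - 1) := by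
      intro l m hl
      obtain rfl : l = m.succ := Fin.ext hl
      rfl
    refine Prod.ext (funext fun i => ?_) (funext fun j => ?_)
    · refine Fin.cases ?_ (fun i => ?_) i
      · rfl
      · have hi : (i : ℕ) < n := by omega
        refine (hs (Fin.cast h.symm (Fin.castAdd (b + 1) i.succ)) ⟨i, hi⟩ (by simp)).trans ?_
        simp only [ins, he1 ⟨i, hi⟩ i rfl]
        rfl
    · refine Fin.cases ?_ (fun j => ?_) j
      · have ha : a < n := by omega
        refine (hs (Fin.cast h.symm (Fin.natAdd (a + 1) 0)) ⟨a, ha⟩ (by simp)).trans ?_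
        simp only [ins, he0 ⟨a, ha⟩ rfl]
        rfl
      · have hj : a + 1 + j < n := by omega
        refine (hs (Fin.cast h.symm (Fin.natAdd (a + 1) j.succ)) ⟨a + 1 + j, hj⟩ (by simp; omega)).trans ?_
        simp only [ins, he2 ⟨a + 1 + j, hj⟩ j rfl]
        rfl
  show attach f g (collapse h (ins e t z)) = _
  unfold attachAt
  rw [← hp]
  rfl

/-- The Whitehead product is the commutator in the torus group, when the loop coordinate is the
first coordinate of the second factor. -/
theorem toTorus_loop (h : n + 1 = a + 1 + (b + 1)) (e : Fin n ≃ Option (Fin a ⊕ Fin b))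
    (he1 : ∀ (m : Fin n) (i : Fin a), (m : ℕ) = i → e m = some (Sum.inl i))
    (he0 : ∀ m : Fin n, (m : ℕ) = a → e m = none)
    (he2 : ∀ (m : Fin n) (j : Fin b), (m : ℕ) = a + 1 + j → e m = some (Sum.inr j)) :
    (toPerLoop ∅ e (loop (Nat.le_add_left 1 a) (Nat.le_add_left 1 b) h f g)).Homotopic
      (((PerLoop.push Sum.inl (toPerLoop ∅ (finSuccEquiv a) f)).trans
        (PerLoop.push Sum.inr (toPerLoop ∅ (finSuccEquiv b) g))).trans
      ((PerLoop.push Sum.inl (toPerLoop ∅ (finSuccEquiv a) f)).symm.trans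
        (PerLoop.push Sum.inr (toPerLoop ∅ (finSuccEquiv b) g)).symm)) := by
  have hr := continuous_cubeRadius (K := Fin a ⊕ Fin b)
  -- From `Φ₀`, the Whitehead loop, to `Φ₁` the radii of `t` and `z` are separated; `Φ₂` drops the
  -- scaling of the square loop by the radius of `z`, and `Φ₃` drops the stretching of `z`.
  let Φ₀ : I × (Fin a ⊕ Fin b → I) → Coord a b := fun y =>
    (clamp (2 - 6 * max |(y.1 : ℝ) - 1 / 2| (cubeRadius y.2)),
      clamp (3 - 6 * max |(y.1 : ℝ) - 1 / 2| (cubeRadius y.2)) * clamp (3 * y.1 - 1),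
      fun k => clamp (3 - 6 * max |(y.1 : ℝ) - 1 / 2| (cubeRadius y.2)) * clamp (3 * y.2 k - 1))
  let Φ₁ : I × (Fin a ⊕ Fin b → I) → Coord a b := fun y =>
    (clamp (2 - 6 * cubeRadius y.2) * sqFst y.1, clamp (2 - 6 * cubeRadius y.2) * sqSnd y.1,
      fun k => clamp (3 * y.2 k - 1))
  let Φ₂ : I × (Fin a ⊕ Fin b → I) → Coord a b := fun y =>
    (sqFst y.1, sqSnd y.1, fun k => clamp (3 * y.2 k - 1))
  let Φ₃ : I × (Fin a ⊕ Fin b → I) → Coord a b := fun y => (sqFst y.1, sqSnd y.1, y.2)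
  have c₀ : Continuous Φ₀ := by fun_prop
  have c₁ : Continuous Φ₁ := by fun_prop
  have c₂ : Continuous Φ₂ := by fun_prop
  have c₃ : Continuous Φ₃ := by fun_prop
  have sq0 : ∀ t : I, (t = 0 ∨ t = 1) → sqFst t = 0 ∧ sqSnd t = 0 := by
    rintro t (rfl | rfl)
    · exact sq_of_le_sixth (by norm_num)
    · have := sq_left (t := 1) (by norm_num)
      exact ⟨this.1, Subtype.ext (by rw [this.2]; norm_num)⟩
  have z₀ : ∀ t z, (t = 0 ∨ t = 1) → (Φ₀ (t, z)).1 = 0 ∧ (Φ₀ (t, z)).2.1 = 0 := by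
    intro t z ht
    have h1 : 1 / 2 ≤ max |(t : ℝ) - 1 / 2| (cubeRadius z) :=
      le_max_of_le_left (abs_sub_half_of_endpoint ht).ge
    refine ⟨clamp_of_le (by linarith), ?_⟩
    simp only [Φ₀]
    rw [clamp_of_le (t := 3 - 6 * max |(t : ℝ) - 1 / 2| (cubeRadius z)) (by linarith), zero_mul]
  have z₁ : ∀ t z, (t = 0 ∨ t = 1) → (Φ₁ (t, z)).1 = 0 ∧ (Φ₁ (t, z)).2.1 = 0 := fun t z ht => by
    simp [Φ₁, sq0 t ht]
  have z₂ : ∀ t z, (t = 0 ∨ t = 1) → (Φ₂ (t, z)).1 = 0 ∧ (Φ₂ (t, z)).2.1 = 0 := fun t z ht => by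
    simp [Φ₂, sq0 t ht]
  have z₃ : ∀ t z, (t = 0 ∨ t = 1) → (Φ₃ (t, z)).1 = 0 ∧ (Φ₃ (t, z)).2.1 = 0 := fun t z ht => by
    simp [Φ₃, sq0 t ht]
  have hκ : ∀ {s s' : I}, (s = s' ∨ ((s = 0 ∨ s = 1) ∧ (s' = 0 ∨ s' = 1))) → ∀ u : I,
      lin u (clamp (3 * s - 1)) s = lin u (clamp (3 * s' - 1)) s' ∨
      ((lin u (clamp (3 * s - 1)) s = 0 ∨ lin u (clamp (3 * s - 1)) s = 1) ∧
       (lin u (clamp (3 * s' - 1)) s' = 0 ∨ lin u (clamp (3 * s' - 1)) s' = 1)) := by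
    have h1 : ∀ (s u : I), (s = 0 ∨ s = 1) →
        lin u (clamp (3 * s - 1)) s = 0 ∨ lin u (clamp (3 * s - 1)) s = 1 := by
      rintro s u (rfl | rfl)
      · left; rw [clamp_of_le (by norm_num), lin_self]
      · right; rw [clamp_of_ge (by norm_num), lin_self]
    rintro s s' (rfl | hs) u
    · exact Or.inl rfl
    · exact Or.inr ⟨h1 s u hs.1, h1 s' u hs.2⟩
  have k₀₁ : ∀ y, Coord.Common (Φ₀ y) (Φ₁ y) := by
    rintro ⟨t, z⟩
    rcases le_or_gt (1 / 3) |(t : ℝ) - 1 / 2| with h1 | h1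
    · have e1 : (Φ₀ (t, z)).1 = 0 := clamp_of_le (by
        have := le_max_left |(t : ℝ) - 1 / 2| (cubeRadius z)
        simp only; linarith)
      have e2 : sqFst t = 0 := clamp_of_le (by linarith)
      refine Or.inl ⟨?_, Or.inl e1⟩
      rw [e1]; simp [Φ₁, e2]
    rcases le_or_gt (1 / 3) (cubeRadius z) with h2 | h2
    · have e1 : (Φ₀ (t, z)).1 = 0 := clamp_of_le (by
        have := le_max_right |(t : ℝ) - 1 / 2| (cubeRadius z)
        simp only; linarith)
      refine Or.inl ⟨?_, Or.inl e1⟩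
      rw [e1]
      simp only [Φ₁]
      rw [clamp_of_le (t := 2 - 6 * cubeRadius z) (by linarith), zero_mul]
    have hμ : clamp (3 - 6 * max |(t : ℝ) - 1 / 2| (cubeRadius z)) = 1 := clamp_of_ge (by
      have := max_lt h1 h2
      linarith)
    rcases lt_or_ge (1 / 6) (cubeRadius z) with h3 | h3
    · obtain ⟨k, hk⟩ := exists_clamp_eq_of_lt_cubeRadius h3
      refine Or.inr (Or.inr ⟨k, ?_, ?_⟩)
      · simp only [Φ₀, Φ₁, hμ, one_mul]
      · simpa only [Φ₀, hμ, one_mul] using hk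
    have hl : clamp (2 - 6 * cubeRadius z) = 1 := clamp_of_ge (by linarith)
    rcases lt_or_ge (1 / 6) |(t : ℝ) - 1 / 2| with h4 | h4
    · have hμ' : clamp (3 - 6 * |(t : ℝ) - 1 / 2|) = 1 := clamp_of_ge (by linarith)
      refine Or.inr (Or.inl ⟨?_, ?_⟩)
      · simp only [Φ₀, Φ₁, hμ, hl, one_mul, sqSnd, hμ']
      · simpa only [Φ₀, hμ, one_mul] using clamp_eq_of_lt_abs h4
    · have e1 : (Φ₀ (t, z)).1 = 1 := clamp_of_ge (by
        have := max_le h4 h3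
        simp only; linarith)
      have e2 : sqFst t = 1 := clamp_of_ge (by linarith)
      refine Or.inl ⟨?_, Or.inr e1⟩
      rw [e1]; simp [Φ₁, e2, hl]
  have k₃ : ∀ y (w : Fin a ⊕ Fin b → I) w', Coord.Common
      ((sqFst y, sqSnd y, w) : Coord a b) (sqFst y, sqSnd y, w') := by
    intro y w w'
    rcases sq_mem y with h | h | h | h
    · exact Or.inl ⟨rfl, Or.inl h⟩
    · exact Or.inl ⟨rfl, Or.inr h⟩
    · exact Or.inr (Or.inl ⟨rfl, Or.inl h⟩)
    · exact Or.inr (Or.inl ⟨rfl, Or.inr h⟩)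
  have k₁₂ : ∀ y, Coord.Common (Φ₁ y) (Φ₂ y) := by
    rintro ⟨t, z⟩
    rcases lt_or_ge (1 / 6) (cubeRadius z) with h3 | h3
    · obtain ⟨k, hk⟩ := exists_clamp_eq_of_lt_cubeRadius h3
      exact Or.inr (Or.inr ⟨k, rfl, hk⟩)
    · have hl : clamp (2 - 6 * cubeRadius z) = 1 := clamp_of_ge (by linarith)
      simp only [Φ₁, Φ₂, hl, one_mul]
      exact k₃ t _ _
  have k₁ : ∀ y, Coord.Common (Φ₁ y) (Φ₁ y) := fun y => by
    simpa [Coord.mix] using (k₁₂ y).mix 0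
  have hc₁₂ : ∀ u t z z', Cong z z' → attachAt f g (Coord.mix u (Φ₁ (t, z)) (Φ₂ (t, z))) =
      attachAt f g (Coord.mix u (Φ₁ (t, z')) (Φ₂ (t, z'))) := by
    intro u t z z' hz
    refine attachAt_cong f g ?_ ?_ fun k => ?_
    · simp only [Coord.mix, Φ₁, Φ₂, hz.cubeRadius_eq]
    · simp only [Coord.mix, Φ₁, Φ₂, hz.cubeRadius_eq]
    · simpa [Coord.mix, Φ₁, Φ₂] using hκ (hz k) 0
  have hc₂₃ : ∀ u t z z', Cong z z' → attachAt f g (Coord.mix u (Φ₂ (t, z)) (Φ₃ (t, z))) =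
      attachAt f g (Coord.mix u (Φ₂ (t, z')) (Φ₃ (t, z'))) := by
    intro u t z z' hz
    exact attachAt_cong f g rfl rfl fun k => hκ (hz k) u
  let δ₁ := attachLoop f g Φ₁ c₁ k₁ z₁
    (fun t z z' hz => by simpa [Coord.mix] using hc₁₂ 0 t z z' hz)
  let δ₂ := attachLoop f g Φ₂ c₂ (fun y => k₃ _ _ _) z₂
    (fun t z z' hz => by simpa [Coord.mix] using hc₂₃ 0 t z z' hz)
  let δ₃ := attachLoop f g Φ₃ c₃ (fun y => k₃ _ _ _) z₃
    (fun t z z' hz => by simpa [Coord.mix] using hc₂₃ 1 t z z' hz)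
  refine Path.Homotopic.trans (p₁ := δ₁) ?_ (Path.Homotopic.trans (p₁ := δ₂) ?_
    (Path.Homotopic.trans (p₁ := δ₃) ?_ ?_))
  · refine attachLoop_homotopic f g Φ₀ Φ₁ c₀ c₁ k₀₁ z₀ z₁ ?_
      (fun t z => loop_ins f g h e he1 he0 he2 t z) (fun _ _ => rfl)
    intro u t z z' hz
    rcases hz.eq_or_mem with hz' | hz'
    · rw [hz']
    -- The interpolated block coordinates need not respect the gluing (0 and 1 go to 0 and `u`). For
    -- `z` on the boundary, however, both square coordinates vanish and the value is `x`.
    · have key : ∀ z ∈ Cube.boundary (Fin a ⊕ Fin b),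
          attachAt f g (Coord.mix u (Φ₀ (t, z)) (Φ₁ (t, z))) = x := by
        intro z hz
        have h1 := half_le_cubeRadius hz
        have h2 := h1.trans (le_max_right |(t : ℝ) - 1 / 2| (cubeRadius z))
        have hl : clamp (2 - 6 * cubeRadius z) = 0 := clamp_of_le (by linarith)
        have hμ : clamp (3 - 6 * max |(t : ℝ) - 1 / 2| (cubeRadius z)) = 0 :=
          clamp_of_le (by linarith)
        have hν : clamp (2 - 6 * max |(t : ℝ) - 1 / 2| (cubeRadius z)) = 0 :=
          clamp_of_le (by linarith)
        refine attachAt_zero f g ?_ ?_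
        · simp only [Coord.mix, Φ₀, Φ₁, hl, hν, zero_mul, lin_self]
        · simp only [Coord.mix, Φ₀, Φ₁, hl, hμ, zero_mul, lin_self]
      rw [key z hz', key z' (hz.mem_boundary hz')]
  · exact attachLoop_homotopic f g Φ₁ Φ₂ c₁ c₂ k₁₂ z₁ z₂ hc₁₂ (fun _ _ => rfl) (fun _ _ => rfl)
  · exact attachLoop_homotopic f g Φ₂ Φ₃ c₂ c₃ (fun y => k₃ _ _ _) z₂ z₃ hc₂₃
      (fun _ _ => rfl) (fun _ _ => rfl)
  · have hins : ∀ {m : ℕ} (t : I) (w : Fin m → I), ins (finSuccEquiv m) t w = Fin.cons t w := by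
      intro m t w
      funext i
      refine Fin.cases ?_ (fun i => ?_) i <;> simp [ins]
    refine homotopic_commutator _ _ δ₃ (fun t ht => ?_) (fun t ht => ?_)
    · refine Subtype.ext (ContinuousMap.ext fun z => ?_)
      refine (attachAt_of_snd f g (c := Φ₃ (t, z)) ht).trans ?_
      rw [PerLoop.push_apply, toPerLoop_apply, hins]
      rfl
    · refine Subtype.ext (ContinuousMap.ext fun z => ?_)
      refine (attachAt_of_fst f g (c := Φ₃ (t, z)) ht).trans ?_
      rw [PerLoop.push_apply, toPerLoop_apply, hins]
      rfl

end Whitehead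

/-! ### Signs and the Jacobi identity -/

namespace Whitehead

variable {M : Type*} [TopologicalSpace M] {x : M} {K K' A B L : Type*} {a b c k : ℕ}

/-- The first coordinate is the loop coordinate, the others are labelled by `o`. -/
def std (o : Fin k ≃ K) : Fin (k + 1) ≃ Option K := (finSuccEquiv k).trans (Equiv.optionCongr o)

theorem std_succ (o : Fin k ≃ K) (m : Fin k) : std o m.succ = some (o m) := by simp [std]

theorem std_trans (o : Fin k ≃ K) (φ : K ≃ K') :
    std (o.trans φ) = (std o).trans (Equiv.optionCongr φ) := by
  ext1 m
  refine Fin.cases ?_ (fun m => ?_) m <;> simp [std]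

theorem std_refl : std (Equiv.refl (Fin k)) = finSuccEquiv k := by
  simp [std]

theorem toTorus_std_trans (hk : 1 ≤ k) (ρ : Equiv.Perm (Fin k)) (o : Fin k ≃ K)
    (g : π_ (k + 1) M x) :
    toTorus (std (ρ.trans o)) g = toTorus (std o) g ^ (Equiv.Perm.sign ρ : ℤ) := by
  have : Nontrivial (Fin (k + 1)) := Fin.nontrivial_iff_two_le.2 (by omega)
  have h : std (ρ.trans o) =
      (((finSuccEquiv k).trans (Equiv.optionCongr ρ)).trans (finSuccEquiv k).symm).trans
        (std o) := by
    ext1 m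
    refine Fin.cases ?_ (fun m => ?_) m <;> simp [std]
  rw [h, toTorus_trans, Equiv.Perm.sign_trans_trans_symm, Equiv.optionCongr_sign]

theorem vanishes_toTorus {N : Type*} (e : N ≃ Option K) (g : HomotopyGroup N M x) (i : K) :
    Vanishes i (toTorus e g) := by
  induction g using Quotient.inductionOn with
  | _ f => exact ⟨_, rfl, fun t z hz => f.2 _ (ins_mem_of_right e t ⟨i, hz⟩)⟩

theorem neg_one_pow_mul_self (m : ℕ) : (-1 : ℤ) ^ m * (-1) ^ m = 1 := by
  rw [← mul_pow]; simp

theorem zpow_neg_one_pow_eq_iff {G : Type*} [Group G] {g h : G} (m : ℕ) :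
    g ^ ((-1 : ℤ) ^ m) = h ↔ g = h ^ ((-1 : ℤ) ^ m) := by
  constructor
  · rintro rfl; rw [← zpow_mul, neg_one_pow_mul_self, zpow_one]
  · rintro rfl; rw [← zpow_mul, neg_one_pow_mul_self, zpow_one]

open scoped commutatorElement

/-- Rewrites the form in which the commutator of paths arrives, since products reverse
concatenation; a commutator commuting with both entries moves across `g * h`. -/
theorem commutatorElement_inv_inv_eq {G : Type*} [Group G] {g h : G}
    (hg : Commute g ⁅h⁻¹, g⁻¹⁆) (hh : Commute h ⁅h⁻¹, g⁻¹⁆) : ⁅h⁻¹, g⁻¹⁆ = ⁅h, g⁆ := by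
  have h1 : h * g = g * h * ⁅h⁻¹, g⁻¹⁆ := by simp [commutatorElement_def, mul_assoc]
  have h2 : g * h * ⁅h⁻¹, g⁻¹⁆ = ⁅h⁻¹, g⁻¹⁆ * (g * h) := (hg.mul_left hh).eq
  rw [h2] at h1
  rw [commutatorElement_def h g, h1]
  simp [mul_assoc]

theorem commutatorElement_zpow_neg_one_pow {G : Type*} [Group G] {g h : G} (m : ℕ)
    (hc : Commute h ⁅g, h ^ ((-1 : ℤ) ^ m)⁆) :
    ⁅g, h ^ ((-1 : ℤ) ^ m)⁆ ^ ((-1 : ℤ) ^ m) = ⁅g, h⁆ := by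
  rcases neg_one_pow_eq_or ℤ m with hm | hm
  · simp [hm]
  · rw [hm, zpow_neg_one] at hc
    rw [hm, zpow_neg_one, zpow_neg_one]
    have h1 : ⁅g, h⁻¹⁆⁻¹ = h⁻¹ * ⁅g, h⁆ * h := by
      simp [commutatorElement_def, mul_assoc]
    have h2 := hc.inv_right.eq
    rw [h1, mul_assoc, mul_inv_cancel_left] at h2
    rw [h1, mul_assoc]
    exact (mul_right_cancel h2).symm

/-- `toTorus_loop` has its loop coordinate at index `a`; moving it to the front is a cycle of length
`a + 1`, of sign `(-1) ^ a`. -/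
theorem toTorus_whitehead (ha : 1 ≤ a) (hb : 1 ≤ b) (h : k + 1 + 1 = a + 1 + (b + 1))
    (o₁ : Fin a ≃ A) (o₂ : Fin b ≃ B) (o : Fin k ≃ A ⊕ B)
    (ho₁ : ∀ (m : Fin k) (i : Fin a), (m : ℕ) = i → o m = Sum.inl (o₁ i))
    (ho₂ : ∀ (m : Fin k) (j : Fin b), (m : ℕ) = a + j → o m = Sum.inr (o₂ j))
    (α : π_ (a + 1) M x) (β : π_ (b + 1) M x) :
    toTorus (std o) (whitehead (Nat.le_add_left 1 a) (Nat.le_add_left 1 b) h α β) ^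
        ((-1 : ℤ) ^ a) =
      ⁅pushHom x (Sum.inr : B → A ⊕ B) (toTorus (std o₂) β),
        pushHom x (Sum.inl : A → A ⊕ B) (toTorus (std o₁) α)⁆ := by
  have : Nontrivial (Fin (k + 1)) := Fin.nontrivial_iff_two_le.2 (by omega)
  set w := whitehead (Nat.le_add_left 1 a) (Nat.le_add_left 1 b) h α β with hw
  set X := pushHom x (Sum.inl : A → A ⊕ B) (toTorus (std o₁) α) with hX
  set Y := pushHom x (Sum.inr : B → A ⊕ B) (toTorus (std o₂) β) with hY
  let m₀ : Fin (k + 1) := ⟨a, by omega⟩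
  let e := (Fin.cycleRange m₀).trans (std o)
  let e' := e.trans (Equiv.optionCongr (Equiv.sumCongr o₁.symm o₂.symm))
  have hsign : toTorus e w = toTorus (std o) w ^ ((-1 : ℤ) ^ a) := by
    rw [toTorus_trans, Fin.sign_cycleRange]
    simp [m₀]
  have he' : toTorus e w = pushHom x (Equiv.sumCongr o₁ o₂) (toTorus e' w) := by
    rw [pushHom_toTorus]
    congr 1
    ext1 m
    simp only [e', Equiv.trans_apply]
    rcases e m with _ | (i | j) <;> simp
  have key : toTorus e' w =
      ⁅(pushHom x (Sum.inr : Fin b → Fin a ⊕ Fin b) (toTorus (finSuccEquiv b) β))⁻¹,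
        (pushHom x (Sum.inl : Fin a → Fin a ⊕ Fin b) (toTorus (finSuccEquiv a) α))⁻¹⁆ := by
    rw [hw]
    induction α, β using Quotient.inductionOn₂ with
    | _ f g =>
    have he0 : ∀ m : Fin (k + 1), (m : ℕ) = a → e' m = none := by
      intro m hm
      obtain rfl : m = m₀ := Fin.ext hm
      simp [e', e, std]
    have he1 : ∀ (m : Fin (k + 1)) (i : Fin a), (m : ℕ) = i → e' m = some (Sum.inl i) := by
      intro m i hm
      have hik : (i : ℕ) < k := by omega
      have h1 : Fin.cycleRange m₀ m = Fin.succ (⟨i, hik⟩ : Fin k) := by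
        apply Fin.ext
        rw [Fin.coe_cycleRange_of_lt]
        · simp [hm]
        · rw [Fin.lt_def, hm]; exact i.2
      simp only [e', e, Equiv.trans_apply, h1, std_succ, ho₁ ⟨i, hik⟩ i rfl]
      simp
    have he2 : ∀ (m : Fin (k + 1)) (j : Fin b), (m : ℕ) = a + 1 + j →
        e' m = some (Sum.inr j) := by
      intro m j hm
      have hjk : a + (j : ℕ) < k := by omega
      have h1 : Fin.cycleRange m₀ m = Fin.succ (⟨a + j, hjk⟩ : Fin k) := by
        rw [Fin.cycleRange_of_gt]
        · apply Fin.ext; simp; omega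
        · rw [Fin.lt_def, hm]; simp only [m₀]; omega
      simp only [e', e, Equiv.trans_apply, h1, std_succ, ho₂ ⟨a + j, hjk⟩ j rfl]
      simp
    have := cls_eq_iff.2 (toTorus_loop f g h e' he1 he0 he2)
    rw [cls_trans, cls_trans, cls_trans, cls_symm, cls_symm] at this
    refine Eq.trans this ?_
    rw [commutatorElement_def, inv_inv, inv_inv, ← mul_assoc]
    rfl
  have hX' : pushHom x (Equiv.sumCongr o₁ o₂)
      (pushHom x (Sum.inl : Fin a → Fin a ⊕ Fin b) (toTorus (finSuccEquiv a) α)) = X := by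
    rw [hX, ← Equiv.refl_trans o₁, std_trans, std_refl, ← pushHom_toTorus, pushHom_pushHom,
      pushHom_pushHom]
    rfl
  have hY' : pushHom x (Equiv.sumCongr o₁ o₂)
      (pushHom x (Sum.inr : Fin b → Fin a ⊕ Fin b) (toTorus (finSuccEquiv b) β)) = Y := by
    rw [hY, ← Equiv.refl_trans o₂, std_trans, std_refl, ← pushHom_toTorus, pushHom_pushHom,
      pushHom_pushHom]
    rfl
  rw [key, map_commutatorElement, map_inv, map_inv, hX', hY'] at he'
  rw [← hsign, he']
  -- The commutator is the image of a homotopy class, hence vanishes in every direction; each entry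
  -- vanishes in some direction of its own block because `a` and `b` are positive.
  refine commutatorElement_inv_inv_eq ?_ ?_
  · rw [← he']
    exact (vanishes_push _ _ _ (o₁ ⟨0, ha⟩)).commute (vanishes_toTorus _ _ _)
  · rw [← he']
    exact (vanishes_push _ _ _ (o₂ ⟨0, hb⟩)).commute (vanishes_toTorus _ _ _)

/-- The labelling of `k` coordinates by three consecutive blocks. -/
def blocks (h : k = a + b + c) : Fin k ≃ (Fin a ⊕ Fin b) ⊕ Fin c :=
  ((finCongr h).trans finSumFinEquiv.symm).trans
    (Equiv.sumCongr finSumFinEquiv.symm (Equiv.refl _))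

theorem blocks_symm_inl_inl (h : k = a + b + c) (i : Fin a) :
    ((blocks h).symm (Sum.inl (Sum.inl i)) : ℕ) = i := by simp [blocks]

theorem blocks_symm_inl_inr (h : k = a + b + c) (i : Fin b) :
    ((blocks h).symm (Sum.inl (Sum.inr i)) : ℕ) = a + i := by simp [blocks]

theorem blocks_symm_inr (h : k = a + b + c) (i : Fin c) :
    ((blocks h).symm (Sum.inr i) : ℕ) = a + b + i := by simp [blocks]

/-- The outer product contributes the sign `(-1) ^ (a + b)` and the inner one `(-1) ^ a`. The inner
sign can be pulled out of the bracket, leaving `(-1) ^ b`. The two commutations are those that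
`hallWitt_of_commute` requires; they hold because the brackets are images of homotopy classes. -/
theorem toTorus_whitehead_whitehead (ha : 1 ≤ a) (hb : 1 ≤ b) (hc : 1 ≤ c) {m : ℕ} (hm : 1 ≤ m)
    (h : m + 1 = a + 1 + (b + 1)) (h' : k + 1 + 1 = m + (c + 1)) (hk : k = a + b + c)
    (φ : (Fin a ⊕ Fin b) ⊕ Fin c ≃ L)
    (α : π_ (a + 1) M x) (β : π_ (b + 1) M x) (γ : π_ (c + 1) M x) {X Y Z : TorusGroup x L}
    (hX : pushHom x (fun i => φ (Sum.inl (Sum.inl i))) (toTorus (finSuccEquiv a) α) = X)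
    (hY : pushHom x (fun i => φ (Sum.inl (Sum.inr i))) (toTorus (finSuccEquiv b) β) = Y)
    (hZ : pushHom x (fun i => φ (Sum.inr i)) (toTorus (finSuccEquiv c) γ) = Z) :
    Commute X ⁅Y, X⁆ ∧ Commute X ⁅Z, ⁅Y, X⁆⁆ ∧
      toTorus (std ((blocks hk).trans φ)) (whitehead hm (Nat.le_add_left 1 c) h'
        (whitehead (Nat.le_add_left 1 a) (Nat.le_add_left 1 b) h α β) γ) ^ ((-1 : ℤ) ^ b) =
      ⁅Z, ⁅Y, X⁆⁆ := by
  obtain rfl : m = a + b + 1 := by omega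
  let o₁₂ : Fin (a + b) ≃ Fin a ⊕ Fin b := finSumFinEquiv.symm
  set δ := whitehead (Nat.le_add_left 1 a) (Nat.le_add_left 1 b) h α β with hδ
  set w := whitehead hm (Nat.le_add_left 1 c) h' δ γ with hw
  have h1 := toTorus_whitehead ha hb h (Equiv.refl _) (Equiv.refl _) o₁₂
    (fun m i hmi => by
      obtain rfl : m = Fin.castAdd b i := Fin.ext hmi
      simp [o₁₂])
    (fun m j hmj => by
      obtain rfl : m = Fin.natAdd a j := Fin.ext hmj
      simp [o₁₂]) α β
  have h2 := toTorus_whitehead (a := a + b) (by omega) hc h' o₁₂ (Equiv.refl _) (blocks hk)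
    (fun m i hmi => by
      obtain rfl : m = Fin.cast hk.symm (Fin.castAdd c i) := Fin.ext hmi
      simp [o₁₂, blocks])
    (fun m j hmj => by
      obtain rfl : m = Fin.cast hk.symm (Fin.natAdd (a + b) j) := Fin.ext hmj
      simp [blocks]) δ γ
  rw [← hδ, std_refl, std_refl] at h1
  rw [← hw, std_refl] at h2
  have h1' := congrArg (pushHom x fun i => φ (Sum.inl i)) h1
  rw [map_commutatorElement, pushHom_pushHom, pushHom_pushHom, map_zpow] at h1'
  replace h1' : pushHom x (fun i => φ (Sum.inl i)) (toTorus (std o₁₂) δ) ^ ((-1 : ℤ) ^ a) =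
    ⁅Y, X⁆ := by rw [h1', ← hX, ← hY]; rfl
  have h2' := congrArg (pushHom x φ) h2
  rw [map_commutatorElement, pushHom_pushHom, pushHom_pushHom, map_zpow, pushHom_toTorus,
    ← std_trans] at h2'
  replace h2' : toTorus (std ((blocks hk).trans φ)) w ^ ((-1 : ℤ) ^ (a + b)) =
      ⁅Z, ⁅Y, X⁆ ^ ((-1 : ℤ) ^ a)⁆ := by
    rw [h2', ← (zpow_neg_one_pow_eq_iff a).1 h1', ← hZ]; rfl
  have hV : ∀ (i : Fin a ⊕ Fin b) (g : TorusGroup x L), Vanishes (φ (Sum.inl i)) g →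
      Commute g ⁅Y, X⁆ := by
    intro i g hg
    rw [← h1']
    exact (hg.commute (vanishes_push (fun i => φ (Sum.inl i)) _ _ i)).zpow_right _
  have hXv : Vanishes (φ (Sum.inl (Sum.inl ⟨0, ha⟩))) X := by
    rw [← hX]; exact vanishes_push (fun i => φ (Sum.inl (Sum.inl i))) _ _ ⟨0, ha⟩
  have h3 := commutatorElement_zpow_neg_one_pow (g := Z) (h := ⁅Y, X⁆) a (by
    rw [← h2']
    exact ((hV (Sum.inl ⟨0, ha⟩) _ (vanishes_toTorus _ _ _)).zpow_left _).symm)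
  have h4 : toTorus (std ((blocks hk).trans φ)) w ^ ((-1 : ℤ) ^ b) = ⁅Z, ⁅Y, X⁆⁆ := by
    rw [← h3, ← h2', ← zpow_mul, pow_add, mul_comm ((-1 : ℤ) ^ a), mul_assoc,
      neg_one_pow_mul_self, mul_one]
  refine ⟨hV (Sum.inl ⟨0, ha⟩) X hXv, ?_, h4⟩
  rw [← h4]
  exact (hXv.commute (vanishes_toTorus _ _ _)).zpow_right _

/-! ### Signs of block rotations -/

theorem sign_of_rotation (ρ : Equiv.Perm (Fin (k + 1))) (s : ℕ)
    (h : ∀ m : Fin (k + 1), (ρ m : ℕ) = (m + s) % (k + 1)) :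
    (Equiv.Perm.sign ρ : ℤ) = (-1) ^ (k * s) := by
  have h1 : ∀ s : ℕ, ∀ m : Fin (k + 1),
      ((finRotate (k + 1) ^ s) m : ℕ) = (m + s) % (k + 1) := by
    intro s
    induction s with
    | zero => intro m; simp [Nat.mod_eq_of_lt m.2]
    | succ s ih =>
      intro m
      rw [pow_succ', Equiv.Perm.mul_apply, finRotate_apply, Fin.val_add, ih,
        Fin.val_one', Nat.add_mod_mod, Nat.mod_add_mod, add_assoc]
  have h2 : ρ = finRotate (k + 1) ^ s := by
    ext m
    rw [h, h1]
  rw [h2, map_pow, sign_finRotate]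
  simp [pow_mul]

/-- The identification of blocks under a cyclic permutation. -/
def rotateBlocks (A B C : Type*) : (B ⊕ C) ⊕ A ≃ (A ⊕ B) ⊕ C :=
  (Equiv.sumComm _ _).trans (Equiv.sumAssoc A B C).symm

/-- Moving the last block, of length `a`, to the front shifts all `k + 1` positions cyclically by
`a`, and a shift by one has sign `(-1) ^ k`. -/
theorem sign_rotateBlocks (h : k + 1 = a + b + c) (h' : k + 1 = b + c + a) :
    (Equiv.Perm.sign (((blocks h').trans (rotateBlocks (Fin a) (Fin b) (Fin c))).trans
      (blocks h).symm) : ℤ) = (-1) ^ (k * a) := by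
  refine sign_of_rotation _ a fun m => ?_
  obtain ⟨y, rfl⟩ := (blocks h').symm.surjective m
  rcases y with (j | l) | i
  · have h1 : (((blocks h).symm (Sum.inl (Sum.inr j)) : Fin (k + 1)) : ℕ) = a + j :=
      blocks_symm_inl_inr h j
    simp only [Equiv.trans_apply, Equiv.apply_symm_apply, blocks_symm_inl_inl]
    refine h1.trans ?_
    rw [Nat.mod_eq_of_lt (by omega), add_comm]
  · have h1 : (((blocks h).symm (Sum.inr l) : Fin (k + 1)) : ℕ) = a + b + l :=
      blocks_symm_inr h l
    simp only [Equiv.trans_apply, Equiv.apply_symm_apply, blocks_symm_inl_inr]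
    refine h1.trans ?_
    rw [Nat.mod_eq_of_lt (by omega)]; omega
  · have h1 : (((blocks h).symm (Sum.inl (Sum.inl i)) : Fin (k + 1)) : ℕ) = i :=
      blocks_symm_inl_inl h i
    simp only [Equiv.trans_apply, Equiv.apply_symm_apply, blocks_symm_inr]
    refine h1.trans ?_
    rw [show b + c + (i : ℕ) + a = i + (k + 1) by omega, Nat.add_mod_right,
      Nat.mod_eq_of_lt (by omega)]

theorem toTorus_rotateBlocks (hk : 1 ≤ k) (h : k + 1 = a + b + c) (h' : k + 1 = b + c + a)
    (φ : (Fin a ⊕ Fin b) ⊕ Fin c ≃ L) (g : π_ (k + 1 + 1) M x) :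
    toTorus (std ((blocks h').trans ((rotateBlocks (Fin a) (Fin b) (Fin c)).trans φ))) g =
      toTorus (std ((blocks h).trans φ)) g ^ ((-1 : ℤ) ^ (k * a)) := by
  rw [← sign_rotateBlocks h h', ← toTorus_std_trans (by omega)]
  congr 2
  ext1 m
  simp

/-- A parity check with `k ≡ a + b + c + 1`. The factor `(-1) ^ b` is the sign of the first double
product, by which the whole relation is normalized. -/
theorem jacobi_signs (h : k + 1 = a + b + c) :
    (-1 : ℤ) ^ ((a + 1) * (b + 1) + (a + 1) * (c + 1)) = (-1) ^ (k * a + c) * (-1) ^ b ∧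
    (-1 : ℤ) ^ ((a + 1) * (c + 1) + (b + 1) * (c + 1)) =
      (-1) ^ (k * a + (k * b + a)) * (-1) ^ b := by
  have hk : Even (k + 1) ↔ Even (a + b + c) := by rw [h]
  rw [← pow_add, ← pow_add]
  simp only [Nat.even_add, Nat.not_even_one] at hk
  constructor <;> apply neg_one_pow_congr <;>
    simp only [Nat.even_add, Nat.even_mul, Nat.not_even_one] <;>
    generalize Even a = A at * <;> generalize Even b = B at * <;>
    generalize Even c = C at * <;> generalize Even k = D at * <;>
    by_cases A <;> by_cases B <;> by_cases C <;> by_cases D <;> simp_all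

/-- The Jacobi identity for Whitehead products. -/
theorem jacobi {p q r n m₁ m₂ m₃ : ℕ} (hp : 2 ≤ p) (hq : 2 ≤ q) (hr : 2 ≤ r)
    (hm₁ : 1 ≤ m₁) (hm₂ : 1 ≤ m₂) (hm₃ : 1 ≤ m₃)
    (hp' : 1 ≤ p) (hq' : 1 ≤ q) (hr' : 1 ≤ r)
    (h₁ : m₁ + 1 = p + q) (h₂ : m₂ + 1 = q + r) (h₃ : m₃ + 1 = r + p)
    (k₁ : n + 1 = m₁ + r) (k₂ : n + 1 = m₂ + p) (k₃ : n + 1 = m₃ + q) [Nontrivial (Fin n)]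
    (α : π_ p M x) (β : π_ q M x) (γ : π_ r M x) :
    whitehead hm₁ hr' k₁ (whitehead hp' hq' h₁ α β) γ
      * whitehead hm₂ hp' k₂ (whitehead hq' hr' h₂ β γ) α ^ ((-1 : ℤ) ^ (p * q + p * r))
      * whitehead hm₃ hq' k₃ (whitehead hr' hp' h₃ γ α) β ^ ((-1 : ℤ) ^ (p * r + q * r)) = 1 := by
  obtain ⟨a, rfl⟩ : ∃ a, p = a + 1 := ⟨p - 1, by omega⟩
  obtain ⟨b, rfl⟩ : ∃ b, q = b + 1 := ⟨q - 1, by omega⟩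
  obtain ⟨c, rfl⟩ : ∃ c, r = c + 1 := ⟨r - 1, by omega⟩
  obtain ⟨k, rfl⟩ : ∃ k, n = k + 1 + 1 := ⟨n - 2, by omega⟩
  have ha : 1 ≤ a := by omega
  have hb : 1 ≤ b := by omega
  have hc : 1 ≤ c := by omega
  have e₁ : k + 1 = a + b + c := by omega
  have e₂ : k + 1 = b + c + a := by omega
  have e₃ : k + 1 = c + a + b := by omega
  have hk : 1 ≤ k := by omega
  set w₁ := whitehead hm₁ hr' k₁ (whitehead hp' hq' h₁ α β) γ with hw₁
  set w₂ := whitehead hm₂ hp' k₂ (whitehead hq' hr' h₂ β γ) α with hw₂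
  set w₃ := whitehead hm₃ hq' k₃ (whitehead hr' hp' h₃ γ α) β with hw₃
  -- All three block orders are labelled by the same set, so that the three double products are
  -- compared in one torus group with the same `X`, `Y`, `Z`.
  let φ₁ : (Fin a ⊕ Fin b) ⊕ Fin c ≃ (Fin a ⊕ Fin b) ⊕ Fin c := Equiv.refl _
  let φ₂ : (Fin b ⊕ Fin c) ⊕ Fin a ≃ (Fin a ⊕ Fin b) ⊕ Fin c :=
    (rotateBlocks (Fin a) (Fin b) (Fin c)).trans φ₁
  let φ₃ : (Fin c ⊕ Fin a) ⊕ Fin b ≃ (Fin a ⊕ Fin b) ⊕ Fin c :=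
    (rotateBlocks (Fin b) (Fin c) (Fin a)).trans φ₂
  let X := pushHom x (fun i => φ₁ (Sum.inl (Sum.inl i))) (toTorus (finSuccEquiv a) α)
  let Y := pushHom x (fun i => φ₁ (Sum.inl (Sum.inr i))) (toTorus (finSuccEquiv b) β)
  let Z := pushHom x (fun i => φ₁ (Sum.inr i)) (toTorus (finSuccEquiv c) γ)
  obtain ⟨c₁, d₁, t₁⟩ := toTorus_whitehead_whitehead ha hb hc hm₁ h₁ k₁ e₁ φ₁ α β γ
    (X := X) (Y := Y) (Z := Z) rfl rfl rfl
  obtain ⟨c₂, d₂, t₂⟩ := toTorus_whitehead_whitehead hb hc ha hm₂ h₂ k₂ e₂ φ₂ β γ α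
    (X := Y) (Y := Z) (Z := X) rfl rfl rfl
  obtain ⟨c₃, d₃, t₃⟩ := toTorus_whitehead_whitehead hc ha hb hm₃ h₃ k₃ e₃ φ₃ γ α β
    (X := Z) (Y := X) (Z := Y) rfl rfl rfl
  rw [← hw₁] at t₁
  -- One block rotation returns the second product to the standard order of coordinates; the third
  -- needs two.
  rw [← hw₂, toTorus_rotateBlocks hk e₁ e₂, ← zpow_mul, ← pow_add] at t₂
  rw [← hw₃, toTorus_rotateBlocks hk e₂ e₃, toTorus_rotateBlocks hk e₁ e₂, ← zpow_mul,
    ← zpow_mul, ← pow_add, ← pow_add] at t₃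
  have hJ := hallWitt_of_commute c₁ c₂ c₃ d₁ d₂ d₃
  let J := toTorusHom (M := M) (x := x) (std ((blocks e₁).trans φ₁))
  replace t₁ : J (w₁ ^ ((-1 : ℤ) ^ b)) = ⁅Z, ⁅Y, X⁆⁆ := (map_zpow J _ _).trans t₁
  replace t₂ : J (w₂ ^ ((-1 : ℤ) ^ (k * a + c))) = ⁅X, ⁅Z, Y⁆⁆ := (map_zpow J _ _).trans t₂
  replace t₃ : J (w₃ ^ ((-1 : ℤ) ^ (k * a + (k * b + a)))) = ⁅Y, ⁅X, Z⁆⁆ :=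
    (map_zpow J _ _).trans t₃
  rw [← t₁, ← t₂, ← t₃, ← map_mul, ← map_mul] at hJ
  -- Injectivity carries the Hall–Witt relation back to the homotopy group, which is commutative, so
  -- the common sign can be distributed over the factors.
  have h1 := toTorusHom_injective _ (hJ.trans (map_one J).symm)
  obtain ⟨s₂, s₃⟩ := jacobi_signs e₁
  have h2 : (w₁ ^ ((-1 : ℤ) ^ b) * w₂ ^ ((-1 : ℤ) ^ (k * a + c)) *
      w₃ ^ ((-1 : ℤ) ^ (k * a + (k * b + a)))) ^ ((-1 : ℤ) ^ b) = 1 :=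
    (congrArg (· ^ ((-1 : ℤ) ^ b)) h1).trans (one_zpow _)
  rw [mul_zpow, mul_zpow, ← zpow_mul, ← zpow_mul, ← zpow_mul, neg_one_pow_mul_self, zpow_one,
    ← s₂, ← s₃] at h2
  exact h2

end Whitehead

end

theorem corollary3p8 {M : Type*} [TopologicalSpace M] (x : M) (p q r : ℕ)
    (hp : 2 ≤ p) (hq : 2 ≤ q) (hr : 2 ≤ r)
    (α : π_ p M x) (β : π_ q M x) (γ : π_ r M x) :
    haveI : Nontrivial (Fin (p + q + r - 2)) := Fin.nontrivial_iff_two_le.2 (by omega)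
    whitehead (p := p + q - 1) (n := p + q + r - 2) (by omega) (by omega) (by omega)
        (whitehead (by omega) (by omega) (by omega) α β) γ
      * whitehead (p := q + r - 1) (n := p + q + r - 2) (by omega) (by omega) (by omega)
        (whitehead (by omega) (by omega) (by omega) β γ) α ^ ((-1 : ℤ) ^ (p * q + p * r))
      * whitehead (p := r + p - 1) (n := p + q + r - 2) (by omega) (by omega) (by omega)
        (whitehead (by omega) (by omega) (by omega) γ α) β ^ ((-1 : ℤ) ^ (p * r + q * r))
      = 1 := by
  have : Nontrivial (Fin (p + q + r - 2)) := Fin.nontrivial_iff_two_le.2 (by omega)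
  exact Whitehead.jacobi hp hq hr _ _ _ _ _ _ _ _ _ _ _ _ α β γ
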